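/- **Fermat reals.** A *little-oh polynomial* is a function $x:[0,\infty)\to\mathbb R$ with $x(t)=r+\sum_{i=1}^N a_i t^{e_i}+o(t)$ as $t\to0^+$, for some $N\in\mathbb N$, $r,a_i\in\mathbb R$ and $e_i\ge 0$. The ring ${}^\bullet\mathbb R$ of Fermat reals is the ring of little-oh polynomials modulo those $x$ with $x(t)=o(t)$ as $t\to0^+$. One writes $x\le y$ in ${}^\bullet\mathbb R$ if there are representatives with $x(t)\le y(t)$ for all small $t>0$. For real $a$, let $\mathrm dt_a$ be the class of $t\mapsto t^{1/a}$ if $a\ge1$, and $\mathrm dt_a=0$ if $a<1$. Every $x\in{}^\bullet\mathbb R$ has a unique decomposition $x={}^\circ x+\sum_{i=1}^N c_i\,\mathrm dt_{\omega_i}$ with ${}^\circ x\in\mathbb R$, $0\neq c_i\in\mathbb R$ and $\omega_1>\dots>\omega_N\ge1$; put $\omega(x)=\omega_1$ if $N\ge1$ and $\omega(x)=0$ if $N=0$. For $s\in\mathbb R$ let $D_s=\{x\in{}^\bullet\mathbb R : {}^\circ x=0,\ \omega(x)<s+1\}$. For $A\subseteq\mathbb R$ and $g:A\to\mathbb R$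 we say that ${}^\bullet g(x)$ is *defined and equal to* $y$ if $x$ has a representative $u$ with $u(t)\in A$ for all small $t>0$, and if for every such representative $g\circ u$ is (for small $t>0$) a little-oh polynomial representing $y$. **Powers.** Let $c=\sum_{i=1}^N c_i\,\mathrm dt_{\omega_i}$ be infinitesimal (i.e. ${}^\circ c=0$) and $p\ge0$. Put $c^0=1$, put $0^p=0$ for $p>0$, and for $c\ne0$, $p>0$ put $$c^p=c_1^{\,p}\,\mathrm dt_{\omega_1/p}\cdot\Bigl(1+\sum_{i=2}^N\frac{c_i}{c_1}\,\mathrm dt_{(1/\omega_i-1/\omega_1)^{-1}}\Bigr)^p ,$$ the last power being the value of the extension of the smooth function $s\mapsto s^p$ on $(0,\infty)$. The power $c^p$ is *defined* if $c\ge0$, or if $p=m/q$ with $m,q\in\mathbb N$ and $q$ odd (then, for $c_1<0$, $c_1^{\,p}=(-1)^m|c_1|^{p}$). **Fractional derivatives.** Let $0<a<b$ and $0<\alpha\le1$. $\mathcal C_0([a,b])$ is the set of functions $g$ on $[a,b]$ of the form $g(x)=x^pg_1(x)$ with $p>0$ and $g_1$ continuous on $[a,b]$. The Caputo derivative of $g:[a,b]\to\mathbb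 R$ is, for $x\in(a,b]$, $$D_a^\alpha g(x)=\frac1{\Gamma(1-\alpha)}\int_a^x (x-t)^{-\alpha}g'(t)\,\mathrm dt\quad(\alpha<1),\qquad D_a^1g(x)=g'(x),$$ and $D_a^\alpha g(a)=\lim_{x\to a^+}D_a^\alpha g(x)$. Let $D_a^{k,\alpha}$ be its $k$-fold iterate ($D_a^{0,\alpha}g=g$), and let $\mathcal C^\infty_\alpha([a,b])$ be the set of smooth $f:[a,b]\to\mathbb R$ such that $D_a^{k,\alpha}f\in\mathcal C_0([a,b])$ for all $k\in\mathbb N$. **Theorem.** Let $\alpha,a',a,b\in\mathbb R$ and $n\in\mathbb N$ with $0\le a'<a<b$ and $0<\alpha\le1$, and let $f\in\mathcal C^\infty_\alpha([a,b])$. 1. For every $h\in D_{(n+1)\alpha-1}$ with $h\ge0$, ${}^\bullet f(a+h)$ (with $f$ on $[a,b]$) is defined, and in ${}^\bullet\mathbb R$ $$f(a+h)=\sum_{i=0}^n\frac{h^{i\alpha}}{\Gamma(i\alpha+1)}\,D_a^{i,\alpha}f(a).$$ 2. If $f$ is moreover defined and smooth on $(a',b)$, then for every $h\in D_{(n+1)\alpha-1}$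 for which the powers $h^{i\alpha}$, $0\le i\le n$, are defined (positive or negative), ${}^\bullet f(a+h)$ (with $f$ on $(a',b)$) is defined, and the same formula holds. -/

import Mathlib

open Filter Topology Asymptotics Set
open scoped NNReal ContDiff

noncomputable section

namespace Fermat

/-! ### The ring of Fermat reals -/

/-- `x : [0,∞) → ℝ` is a little-oh polynomial: `x t = r + ∑ aᵢ t ^ eᵢ + o(t)` as `t → 0⁺`,
for some real `r`, `aᵢ` and real exponents `eᵢ ≥ 0`. -/
def IsLittleOhPoly (x : ℝ≥0 → ℝ) : Prop :=
  ∃ (r : ℝ) (N : ℕ) (a e : Fin N → ℝ), (∀ i, 0 ≤ e i) ∧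
    (fun t : ℝ≥0 => x t - (r + ∑ i, a i * (t : ℝ) ^ (e i))) =o[𝓝[>] 0] (fun t : ℝ≥0 => (t : ℝ))

theorem tendsto_coe_zero : Tendsto (fun t : ℝ≥0 => (t : ℝ)) (𝓝[>] 0) (𝓝 0) := by
  have : Tendsto (fun t : ℝ≥0 => (t : ℝ)) (𝓝 0) (𝓝 ((0 : ℝ≥0) : ℝ)) :=
    NNReal.continuous_coe.tendsto 0
  simpa using this.mono_left nhdsWithin_le_nhds

theorem tendsto_rpow_zero {e : ℝ} (he : 0 < e) :
    Tendsto (fun t : ℝ≥0 => (t : ℝ) ^ e) (𝓝[>] 0) (𝓝 0) := by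
  have := tendsto_coe_zero.rpow_const (p := e) (Or.inr he.le)
  rwa [Real.zero_rpow he.ne'] at this

theorem eventually_pos : ∀ᶠ t : ℝ≥0 in 𝓝[>] 0, (0 : ℝ) < t := by
  filter_upwards [self_mem_nhdsWithin] with t ht
  exact_mod_cast ht

theorem rpow_isLittleO {p q : ℝ} (h : p < q) :
    (fun t : ℝ≥0 => (t : ℝ) ^ q) =o[𝓝[>] 0] (fun t : ℝ≥0 => (t : ℝ) ^ p) := by
  rw [isLittleO_iff_tendsto']
  · refine (tendsto_rpow_zero (sub_pos.2 h)).congr' ?_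
    filter_upwards [eventually_pos] with t ht
    rw [Real.rpow_sub ht]
  · filter_upwards [eventually_pos] with t ht h0
    exact absurd h0 (Real.rpow_pos_of_pos ht p).ne'

theorem rpow_isBigO_one {e : ℝ} (he : 0 ≤ e) :
    (fun t : ℝ≥0 => (t : ℝ) ^ e) =O[𝓝[>] 0] (fun _ : ℝ≥0 => (1 : ℝ)) := by
  have := tendsto_coe_zero.rpow_const (p := e) (Or.inr he)
  exact this.isBigO_one ℝ

namespace IsLittleOhPoly

theorem of_isLittleO {x y : ℝ≥0 → ℝ} (hy : IsLittleOhPoly y)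
    (h : (fun t => x t - y t) =o[𝓝[>] 0] (fun t : ℝ≥0 => (t : ℝ))) : IsLittleOhPoly x := by
  obtain ⟨r, N, a, e, he, ho⟩ := hy
  refine ⟨r, N, a, e, he, (h.add ho).congr_left fun t => ?_⟩
  ring

theorem const (c : ℝ) : IsLittleOhPoly (fun _ => c) :=
  ⟨c, 0, Fin.elim0, Fin.elim0, fun i => i.elim0, by simp⟩

theorem monomial (c : ℝ) {e : ℝ} (he : 0 ≤ e) :
    IsLittleOhPoly (fun t => c * (t : ℝ) ^ e) :=
  ⟨0, 1, fun _ => c, fun _ => e, fun _ => he, by simp⟩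

theorem add {x y : ℝ≥0 → ℝ} (hx : IsLittleOhPoly x) (hy : IsLittleOhPoly y) :
    IsLittleOhPoly (fun t => x t + y t) := by
  obtain ⟨r, N, a, e, he, ho⟩ := hx
  obtain ⟨s, M, b, k, hk, ho'⟩ := hy
  refine ⟨r + s, N + M, Fin.append a b, Fin.append e k, fun i => ?_,
    (ho.add ho').congr_left fun t => ?_⟩
  · refine Fin.addCases (fun i => ?_) (fun i => ?_) i
    · simpa using he i
    · simpa using hk i
  · simp only [Fin.sum_univ_add, Fin.append_left, Fin.append_right]
    ring

theorem sum {ι : Type*} (s : Finset ι) {x : ι → ℝ≥0 → ℝ} (h : ∀ i ∈ s, IsLittleOhPoly (x i)) :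
    IsLittleOhPoly (fun t => ∑ i ∈ s, x i t) := by
  classical
  induction s using Finset.induction_on with
  | empty => simpa using const 0
  | insert i s hi ih =>
    simp only [Finset.sum_insert hi]
    exact (h i (Finset.mem_insert_self i s)).add
      (ih fun j hj => h j (Finset.mem_insert_of_mem hj))

theorem isBigO_one {x : ℝ≥0 → ℝ} (hx : IsLittleOhPoly x) :
    x =O[𝓝[>] 0] (fun _ : ℝ≥0 => (1 : ℝ)) := by
  obtain ⟨r, N, a, e, he, ho⟩ := hx
  have h1 : (fun t : ℝ≥0 => (t : ℝ)) =O[𝓝[>] 0] (fun _ : ℝ≥0 => (1 : ℝ)) :=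
    tendsto_coe_zero.isBigO_one ℝ
  have h2 : (fun t : ℝ≥0 => r + ∑ i, a i * (t : ℝ) ^ (e i)) =O[𝓝[>] 0]
      (fun _ : ℝ≥0 => (1 : ℝ)) :=
    (isBigO_const_const r one_ne_zero _).add
      (IsBigO.fun_sum fun i _ => (rpow_isBigO_one (he i)).const_mul_left (a i))
  exact ((ho.isBigO.trans h1).add h2).congr_left fun t => by ring

theorem mul {x y : ℝ≥0 → ℝ} (hx : IsLittleOhPoly x) (hy : IsLittleOhPoly y) :
    IsLittleOhPoly (fun t => x t * y t) := by
  have hxb := hx.isBigO_one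
  obtain ⟨r, N, a, e, he, ho⟩ := hx
  obtain ⟨s, M, b, k, hk, ho'⟩ := hy
  have hq : IsLittleOhPoly (fun t => s + ∑ i, b i * (t : ℝ) ^ (k i)) :=
    (const s).add (sum _ fun i _ => monomial (b i) (hk i))
  have hpq : IsLittleOhPoly (fun t : ℝ≥0 => (r + ∑ i, a i * (t : ℝ) ^ (e i)) *
      (s + ∑ i, b i * (t : ℝ) ^ (k i))) := by
    have h1 : IsLittleOhPoly (fun t : ℝ≥0 => r * s + ∑ j, (r * b j) * (t : ℝ) ^ (k j) +
        ∑ i, ((s * a i) * (t : ℝ) ^ (e i) + ∑ j, (a i * b j) * (t : ℝ) ^ (e i + k j))) := by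
      refine ((const _).add (sum _ fun j _ => monomial _ (hk j))).add (sum _ fun i _ => ?_)
      exact (monomial _ (he i)).add
        (sum _ fun j _ => monomial _ (add_nonneg (he i) (hk j)))
    convert h1 using 2 with t
    have h2 : ∀ i j, (t : ℝ) ^ (e i + k j) = (t : ℝ) ^ e i * (t : ℝ) ^ k j := fun i j =>
      Real.rpow_add_of_nonneg t.2 (he i) (hk j)
    have h3 : (∑ i, a i * (t : ℝ) ^ (e i)) * (s + ∑ j, b j * (t : ℝ) ^ (k j)) =
        ∑ i, ((s * a i) * (t : ℝ) ^ (e i) + ∑ j, (a i * b j) * (t : ℝ) ^ (e i + k j)) := by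
      rw [Finset.sum_mul]
      refine Finset.sum_congr rfl fun i _ => ?_
      rw [mul_add, Finset.mul_sum]
      congr 1
      · ring
      · refine Finset.sum_congr rfl fun j _ => ?_
        rw [h2]; ring
    rw [add_mul, h3, mul_add, Finset.mul_sum]
    congr 2
    refine Finset.sum_congr rfl fun j _ => ?_
    ring
  refine hpq.of_isLittleO ?_
  have h1 := hxb.mul_isLittleO ho'
  have h2 := ho.mul_isBigO hq.isBigO_one
  simp only [one_mul] at h1
  simp only [mul_one] at h2
  exact (h1.add h2).congr_left fun t => by ring

end IsLittleOhPoly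

/-- The ring of little-oh polynomials. -/
def littleOhPoly : Subalgebra ℝ (ℝ≥0 → ℝ) where
  carrier := {x | IsLittleOhPoly x}
  mul_mem' hx hy := hx.mul hy
  add_mem' hx hy := hx.add hy
  algebraMap_mem' r := IsLittleOhPoly.const r

/-- The little-oh polynomials `x` with `x t = o(t)` as `t → 0⁺`. -/
def negligible : Ideal littleOhPoly where
  carrier := {x | (x : ℝ≥0 → ℝ) =o[𝓝[>] 0] (fun t : ℝ≥0 => (t : ℝ))}
  add_mem' hx hy := IsLittleO.add hx hy
  zero_mem' := isLittleO_zero _ _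
  smul_mem' c x hx := by
    have := (IsLittleOhPoly.isBigO_one c.2).mul_isLittleO hx
    simp only [one_mul] at this
    exact this

/-- The ring of Fermat reals: little-oh polynomials modulo `o(t)` as `t → 0⁺`. -/
def FermatReal : Type := littleOhPoly ⧸ negligible

instance : CommRing FermatReal := inferInstanceAs (CommRing (littleOhPoly ⧸ negligible))

instance : Algebra ℝ FermatReal := inferInstanceAs (Algebra ℝ (littleOhPoly ⧸ negligible))

/-- The Fermat real represented by a little-oh polynomial. -/
def toFermat : littleOhPoly →ₐ[ℝ] FermatReal := Ideal.Quotient.mkₐ ℝ negligible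

theorem toFermat_eq_iff {u v : littleOhPoly} : toFermat u = toFermat v ↔
    (fun t => (u : ℝ≥0 → ℝ) t - (v : ℝ≥0 → ℝ) t) =o[𝓝[>] 0] (fun t : ℝ≥0 => (t : ℝ)) :=
  Ideal.Quotient.eq

/-- The order of the Fermat reals: `x ≤ y` if there are representatives `u`, `v` of `x`, `y`
with `u t ≤ v t` for all sufficiently small `t > 0`. -/
instance : LE FermatReal where
  le x y := ∃ u v : littleOhPoly, toFermat u = x ∧ toFermat v = y ∧
    ∀ᶠ t in 𝓝[>] (0 : ℝ≥0), (u : ℝ≥0 → ℝ) t ≤ (v : ℝ≥0 → ℝ) t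

/-- The infinitesimal `dt_a`: the class of `t ↦ t ^ (1 / a)` if `a ≥ 1`, and `0` if `a < 1`. -/
def dt (a : ℝ) : FermatReal :=
  if h : 1 ≤ a then
    toFermat ⟨fun t => 1 * (t : ℝ) ^ (1 / a),
      IsLittleOhPoly.monomial 1 (one_div_nonneg.2 (zero_le_one.trans h))⟩
  else 0

/-- `x = r + ∑ c(a) dt_a`, a finite sum over pairwise different `a ≥ 1`, with `c(a) ≠ 0`:
the decomposition of the Fermat real `x`. The finitely supported function `c` sends an order
`a` occurring in the decomposition to its coefficient (and every other real to `0`). -/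
def IsDecomposition (x : FermatReal) (r : ℝ) (c : ℝ →₀ ℝ) : Prop :=
  (∀ a ∈ c.support, 1 ≤ a) ∧ x = algebraMap ℝ FermatReal r + c.sum fun a k => k • dt a

theorem IsDecomposition.add {x y : FermatReal} {r s : ℝ} {c d : ℝ →₀ ℝ}
    (hx : IsDecomposition x r c) (hy : IsDecomposition y s d) :
    IsDecomposition (x + y) (r + s) (c + d) := by
  classical
  refine ⟨fun a ha => ?_, ?_⟩
  · rcases Finset.mem_union.1 (Finsupp.support_add ha) with h | h
    · exact hx.1 a h
    · exact hy.1 a h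
  · rw [hx.2, hy.2, map_add, Finsupp.sum_add_index' (by simp) (by intros; rw [add_smul])]
    ring

theorem exists_decomposition_monomial (k : ℝ) {e : ℝ} (he : 0 ≤ e) :
    ∃ r c, IsDecomposition
      (toFermat ⟨fun t => k * (t : ℝ) ^ e, IsLittleOhPoly.monomial k he⟩) r c := by
  rcases he.eq_or_lt with rfl | h0
  · refine ⟨k, 0, by simp, ?_⟩
    rw [Finsupp.sum_zero_index, add_zero]
    rw [← AlgHom.commutes toFermat]
    congr 1
    ext t
    simp
  by_cases h1 : e ≤ 1
  · have h2 : 1 ≤ 1 / e := by rw [le_div_iff₀ h0]; linarith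
    refine ⟨0, Finsupp.single (1 / e) k, fun a ha => ?_, ?_⟩
    · have := Finsupp.support_single_subset ha
      rw [Finset.mem_singleton] at this
      rwa [this]
    · rw [Finsupp.sum_single_index (by simp), map_zero, zero_add, dt, dif_pos h2,
        ← map_smul]
      congr 1
      ext t
      simp
  · refine ⟨0, 0, by simp, ?_⟩
    rw [Finsupp.sum_zero_index, add_zero, map_zero]
    rw [← map_zero toFermat, toFermat_eq_iff]
    have := (rpow_isLittleO (not_le.1 h1)).const_mul_left k
    simpa using this

theorem exists_decomposition (x : FermatReal) : ∃ r c, IsDecomposition x r c := by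
  obtain ⟨⟨u, r, N, a, e, he, ho⟩, rfl⟩ := Ideal.Quotient.mk_surjective x
  let m : Fin N → littleOhPoly := fun i =>
    ⟨fun t => a i * (t : ℝ) ^ (e i), IsLittleOhPoly.monomial _ (he i)⟩
  have hs : ∀ s : Finset (Fin N), ∃ r c, IsDecomposition (∑ i ∈ s, toFermat (m i)) r c := by
    classical
    intro s
    induction s using Finset.induction_on with
    | empty => exact ⟨0, 0, by simp, by simp⟩
    | insert i s hi ih =>
      obtain ⟨r, c, h⟩ := ih
      obtain ⟨r', c', h'⟩ := exists_decomposition_monomial (a i) (he i)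
      rw [Finset.sum_insert hi]
      exact ⟨_, _, h'.add h⟩
  obtain ⟨r', c', h'⟩ := hs Finset.univ
  have h0 : IsDecomposition (algebraMap ℝ FermatReal r) r 0 := ⟨by simp, by simp⟩
  have heq : (Ideal.Quotient.mk negligible ⟨u, r, N, a, e, he, ho⟩ : FermatReal) =
      algebraMap ℝ FermatReal r + ∑ i, toFermat (m i) := by
    rw [← AlgHom.commutes toFermat, ← map_sum, ← map_add]
    refine toFermat_eq_iff.2 (ho.congr_left fun t => ?_)
    simp [m, Finset.sum_apply]
  exact ⟨_, _, heq ▸ h0.add h'⟩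

theorem isDecomposition_zero {r : ℝ} {c : ℝ →₀ ℝ} (h : IsDecomposition 0 r c) :
    r = 0 ∧ c = 0 := by
  obtain ⟨hc, hx⟩ := h
  have key : (fun t : ℝ≥0 => r + ∑ a ∈ c.support, c a * (t : ℝ) ^ (1 / a)) =o[𝓝[>] 0]
      (fun t : ℝ≥0 => (t : ℝ)) := by
    let m : {a // a ∈ c.support} → littleOhPoly := fun a =>
      ⟨fun t => c a * (t : ℝ) ^ (1 / (a : ℝ)),
        IsLittleOhPoly.monomial _ (one_div_nonneg.2 (zero_le_one.trans (hc a a.2)))⟩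
    have h1 : toFermat (algebraMap ℝ littleOhPoly r + ∑ a, m a) = toFermat 0 := by
      rw [map_zero]
      refine Eq.trans ?_ hx.symm
      rw [Finsupp.sum, ← Finset.sum_attach c.support, map_add, map_sum, AlgHom.commutes]
      refine congrArg _ (Finset.sum_congr rfl fun a _ => ?_)
      rw [dt, dif_pos (hc a a.2), ← map_smul]
      congr 1
      ext t
      simp [m]
    rw [toFermat_eq_iff] at h1
    refine h1.congr_left fun t => ?_
    rw [← Finset.sum_attach c.support]
    simp [m, Finset.sum_apply]
  have hr : r = 0 := by
    have h1 : Tendsto (fun t : ℝ≥0 => r + ∑ a ∈ c.support, c a * (t : ℝ) ^ (1 / a)) (𝓝[>] 0)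
        (𝓝 (r + ∑ a ∈ c.support, c a * 0)) :=
      tendsto_const_nhds.add (tendsto_finsetSum _ fun a ha =>
        (tendsto_rpow_zero (one_div_pos.2 (zero_lt_one.trans_le (hc a ha)))).const_mul (c a))
    have h2 := key.isBigO.trans_tendsto tendsto_coe_zero
    simpa using tendsto_nhds_unique h1 h2
  refine ⟨hr, ?_⟩
  by_contra hne
  have hn : c.support.Nonempty := Finsupp.support_nonempty_iff.2 hne
  set w := c.support.max' hn with hw
  have hwm : w ∈ c.support := Finset.max'_mem _ _
  have hw1 : 1 ≤ w := hc w hwm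
  have hwle : (1 : ℝ) / w ≤ 1 := by rw [div_le_one (by linarith)]; exact hw1
  have h1 : (fun t : ℝ≥0 => (t : ℝ)) =O[𝓝[>] 0] (fun t : ℝ≥0 => (t : ℝ) ^ (1 / w)) := by
    rcases hwle.eq_or_lt with h | h
    · rw [h]; simpa using isBigO_refl _ _
    · simpa using (rpow_isLittleO h).isBigO
  have h2 : (fun t : ℝ≥0 => ∑ a ∈ c.support.erase w, c a * (t : ℝ) ^ (1 / a)) =o[𝓝[>] 0]
      (fun t : ℝ≥0 => (t : ℝ) ^ (1 / w)) := by
    refine IsLittleO.fun_sum fun a ha => (rpow_isLittleO ?_).const_mul_left _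
    have ha' := Finset.mem_of_mem_erase ha
    have : a < w := lt_of_le_of_ne (Finset.le_max' _ _ ha') (Finset.ne_of_mem_erase ha)
    exact one_div_lt_one_div_of_lt (by linarith [hc a ha']) this
  have h3 : (fun t : ℝ≥0 => c w * (t : ℝ) ^ (1 / w)) =o[𝓝[>] 0]
      (fun t : ℝ≥0 => (t : ℝ) ^ (1 / w)) := by
    refine ((key.trans_isBigO h1).sub h2).congr_left fun t => ?_
    rw [hr, ← Finset.add_sum_erase _ _ hwm]
    ring
  have h4 := (isLittleO_const_mul_left_iff (Finsupp.mem_support_iff.1 hwm)).1 h3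
  have h5 : ∀ᶠ t : ℝ≥0 in 𝓝[>] 0, (t : ℝ) ^ (1 / w) = 0 := by
    have := isLittleO_irrefl' (l := 𝓝[>] (0 : ℝ≥0)) (f' := fun t : ℝ≥0 => (t : ℝ) ^ (1 / w))
    by_contra hcon
    refine this ?_ h4
    rw [Filter.not_eventually] at hcon
    exact hcon.mono fun t ht => by simpa using ht
  obtain ⟨t, ht, ht'⟩ := (h5.and eventually_pos).exists
  exact (Real.rpow_pos_of_pos ht' _).ne' ht

/-- The decomposition of a Fermat real is unique. -/
theorem decomposition_unique {x : FermatReal} {r s : ℝ} {c d : ℝ →₀ ℝ}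
    (h : IsDecomposition x r c) (h' : IsDecomposition x s d) : r = s ∧ c = d := by
  have hneg : IsDecomposition (-x) (-s) (-d) := by
    refine ⟨fun a ha => h'.1 a (by simpa using ha), ?_⟩
    rw [h'.2, Finsupp.sum_neg_index (by simp), Finsupp.sum]
    simp only [neg_smul, Finset.sum_neg_distrib, map_neg, neg_add, Finsupp.sum]
  have h0 := h.add hneg
  rw [add_neg_cancel] at h0
  obtain ⟨h1, h2⟩ := isDecomposition_zero h0
  exact ⟨by linarith, by rwa [← sub_eq_add_neg, sub_eq_zero] at h2⟩

/-- The standard part `°x` of a Fermat real. -/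
def stdPart (x : FermatReal) : ℝ := (exists_decomposition x).choose

/-- The coefficients of the decomposition of a Fermat real, indexed by the orders. -/
def coeffs (x : FermatReal) : ℝ →₀ ℝ := (exists_decomposition x).choose_spec.choose

theorem isDecomposition_coeffs (x : FermatReal) : IsDecomposition x (stdPart x) (coeffs x) :=
  (exists_decomposition x).choose_spec.choose_spec

/-- The order `ω(x)`: the largest order in the decomposition of `x`, and `0` if `x` is real. -/
def order (x : FermatReal) : ℝ :=
  if h : (coeffs x).support.Nonempty then (coeffs x).support.max' h else 0

/-- `D_a`: the infinitesimals of order `< a + 1`. -/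
def D (a : ℝ) : Set FermatReal := {x | stdPart x = 0 ∧ order x < a + 1}

/-! ### Extension of functions, and powers of infinitesimals -/

/-- The extension to Fermat reals of the real function `f` on `A ⊆ ℝ` is defined at `x` and has
the value `y`: there is a representative `u` of `x` with `u t ∈ A` for small `t > 0`, and for
every such representative, `f ∘ u` is a little-oh polynomial that represents `y`. -/
def HasExtValue (f : ℝ → ℝ) (A : Set ℝ) (x y : FermatReal) : Prop :=
  (∃ u : littleOhPoly, toFermat u = x ∧ ∀ᶠ t in 𝓝[>] (0 : ℝ≥0), (u : ℝ≥0 → ℝ) t ∈ A) ∧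
  ∀ u : littleOhPoly, toFermat u = x → (∀ᶠ t in 𝓝[>] (0 : ℝ≥0), (u : ℝ≥0 → ℝ) t ∈ A) →
    ∃ h : (fun t => f ((u : ℝ≥0 → ℝ) t)) ∈ littleOhPoly, toFermat ⟨_, h⟩ = y

open Classical in
/-- The value at `x` of the extension of `f` on `A` (`0` where the extension is undefined). -/
def ext (f : ℝ → ℝ) (A : Set ℝ) (x : FermatReal) : FermatReal :=
  if h : ∃ y, HasExtValue f A x y then h.choose else 0

open Classical in
/-- The real power `x ^ p`, `x ≠ 0`, where `x < 0` is admitted for `p = m / q` with `q` odd: then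
it is `|x| ^ p` for even `m` and `-|x| ^ p` for odd `m`. -/
def realPow (x p : ℝ) : ℝ :=
  if x < 0 ∧ ∃ m q : ℕ, Odd m ∧ Odd q ∧ p = m / q then -(|x| ^ p) else |x| ^ p

/-- The power `c ^ p` of an infinitesimal `c` can be formed: `p ≥ 0`, and `c ≥ 0` or
`p = m / q` with natural `m`, `q` and odd `q`. -/
def PowDefined (c : FermatReal) (p : ℝ) : Prop :=
  0 ≤ p ∧ (0 ≤ c ∨ ∃ m q : ℕ, Odd q ∧ p = m / q)

open Classical in
/-- The power `c ^ p` of an infinitesimal `c = ∑ cᵢ dt_{ωᵢ}`, `ω = ω₁ > ω₂ > …`, for `p ≥ 0`: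
`c ^ p = c₁ ^ p • dt_{ω / p} * (1 + ∑_{i ≥ 2} (cᵢ / c₁) dt_{1 / (1 / ωᵢ - 1 / ω)}) ^ p`,
the last power being the extension of the smooth function `s ↦ s ^ p` on `(0, ∞)`;
moreover `c ^ 0 = 1`, and `0 ^ p = 0` for `p > 0`. -/
def infPow (c : FermatReal) (p : ℝ) : FermatReal :=
  if p = 0 then 1
  else if c = 0 then 0
  else
    realPow (coeffs c (order c)) p •
      (dt (order c / p) *
        ext (fun s => s ^ p) (Ioi 0)
          (1 + ∑ w ∈ (coeffs c).support.erase (order c),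
            (coeffs c w / coeffs c (order c)) • dt (1 / (1 / w - 1 / order c))))

/-! ### Fractional derivatives -/

/-- The functions `g` on `s` of the form `g x = x ^ p * g₁ x` for some `p > μ` and some
continuous `g₁` on `s`. -/
def powerCont (μ : ℝ) (s : Set ℝ) : Set (ℝ → ℝ) :=
  {g | ∃ p > μ, ∃ g₁ : ℝ → ℝ, ContinuousOn g₁ s ∧ ∀ x ∈ s, g x = x ^ p * g₁ x}

/-- The Riemann-Liouville integral operator `J_a^β`, for `x > a` and `β ≥ 0`. -/
def riemannLiouville (a β : ℝ) (g : ℝ → ℝ) (x : ℝ) : ℝ :=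
  if β = 0 then g x else 1 / Real.Gamma β * ∫ t in a..x, (x - t) ^ (β - 1) * g t

/-- The Caputo derivative `D_a^α g = J_a^{m - α} g^{(m)}`, `m = ⌈α⌉`, of a function on `[a, b]`.
As `J_a` is defined on `x > a` only, the value at `x = a` is the limit `x → a⁺`. -/
def caputo (a b α : ℝ) (g : ℝ → ℝ) (x : ℝ) : ℝ :=
  if x = a then
    limUnder (𝓝[>] a)
      (riemannLiouville a (⌈α⌉₊ - α) (iteratedDerivWithin ⌈α⌉₊ g (Icc a b)))
  else riemannLiouville a (⌈α⌉₊ - α) (iteratedDerivWithin ⌈α⌉₊ g (Icc a b)) x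

/-- `C_α^∞([a, b])`: the smooth functions on `[a, b]` all of whose iterated Caputo derivatives
`D_a^{k,α} f = D_a^α (⋯ (D_a^α f))`, `k ≥ 0`, lie in `C_0([a, b])`. -/
def smoothFrac (a b α : ℝ) : Set (ℝ → ℝ) :=
  {f | ContDiffOn ℝ ∞ f (Icc a b) ∧ ∀ k : ℕ, (caputo a b α)^[k] f ∈ powerCont 0 (Icc a b)}

end Fermat

end

/-! Since `a > 0`, membership of the iterated Caputo derivatives in `powerCont 0` makes them
continuous on `[a, b]`, and this is far more restrictive than it looks. Normalized powers of `x - a`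
are shifted by the Riemann-Liouville integrals (`riemannLiouville_rpow`), so the `k`-th iterate of
the smooth function `f` has an explicit expansion at `a`, led, up to a constant, by the `m`-th
derivative of `f` at `a` times `(x - a) ^ (m - k * α)`, where `m = ⌊k * α⌋ + 1`. One more Caputo
derivative lowers the exponent by `α`. A negative exponent would contradict continuity, so the
coefficient vanishes; exponent zero makes the coefficient the value at `a`; a positive exponent
gives value zero. By induction (`exists_expansion_caputo_iterate`), the `k`-th iterate at `a` is the
`j`-th derivative of `f` if `k * α = j` is a natural number and zero otherwise, and all derivatives
of `f` at `a` of order outside `ℕ * α` vanish. Only natural powers of `h` therefore survive in the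
fractional Taylor sum, and for these `infPow` is the ring power (`infPow_natCast`). The sum is the
classical Taylor polynomial (`sum_caputo_smul_infPow`): a missing term has degree `j ≥ (n + 1) * α`,
above the order of `h`, so `h ^ j = 0` (`pow_eq_zero_of_order_lt`). For the same reason `h ^ (n + 1)
= 0`, so the Taylor remainder is `o(t)` along every representative (`hasExtValue_of_isLittleO`). -/

noncomputable section

namespace Fermat

/-! ### Monomials in the Fermat reals -/

/-- The Fermat real represented by `t ↦ t ^ e`. -/
def tpow (e : ℝ≥0) : FermatReal :=
  toFermat ⟨fun t => 1 * (t : ℝ) ^ (e : ℝ), IsLittleOhPoly.monomial 1 e.2⟩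

theorem tpow_add (e k : ℝ≥0) : tpow (e + k) = tpow e * tpow k := by
  rw [tpow, tpow, tpow, ← map_mul]
  congr 1
  ext t
  simpa using Real.rpow_add_of_nonneg t.2 e.2 k.2

theorem tpow_zero : tpow 0 = 1 := by
  rw [tpow, ← map_one toFermat]
  congr 1
  ext t
  simp

theorem tpow_nat_mul (n : ℕ) (e : ℝ≥0) : tpow (n * e) = tpow e ^ n := by
  induction n with
  | zero => simp [tpow_zero]
  | succ n ih => rw [pow_succ, ← ih, ← tpow_add]; congr 1; push_cast; ring

theorem tpow_eq_zero {e : ℝ≥0} (he : 1 < e) : tpow e = 0 := by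
  rw [tpow, ← map_zero toFermat, toFermat_eq_iff]
  simpa using rpow_isLittleO (p := 1) (q := e) (by exact_mod_cast he)

/-- The convention `dt a = 0` for `a < 1` agrees with `t ^ (1 / a) = o(t)`. This removes the case
distinction: products of `dt`'s reduce to adding exponents. -/
theorem dt_eq_tpow {a : ℝ} (ha : 0 < a) : dt a = tpow (1 / a).toNNReal := by
  have h0 : ((1 / a).toNNReal : ℝ) = 1 / a := Real.coe_toNNReal _ (by positivity)
  by_cases h : 1 ≤ a
  · rw [dt, dif_pos h, tpow]
    simp only [h0]
  · rw [dt, dif_neg h, tpow_eq_zero]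
    rw [← NNReal.coe_lt_coe, h0, NNReal.coe_one, one_lt_div ha]
    exact not_le.1 h

theorem dt_div_nat {a : ℝ} (ha : 0 < a) {j : ℕ} (hj : j ≠ 0) : dt (a / j) = dt a ^ j := by
  have hj0 : (0 : ℝ) < j := by positivity
  rw [dt_eq_tpow (div_pos ha hj0), dt_eq_tpow ha, ← tpow_nat_mul]
  congr 1
  rw [one_div_div, div_eq_mul_one_div, Real.toNNReal_mul hj0.le, Real.toNNReal_natCast]

/-- The exponents add up: `1 / a + (1 / w - 1 / a) = 1 / w`. -/
theorem dt_mul_dt {w a : ℝ} (hw : 0 < w) (hwa : w < a) :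
    dt a * dt (1 / (1 / w - 1 / a)) = dt w := by
  have ha := hw.trans hwa
  have h0 : 0 < 1 / w - 1 / a := sub_pos.2 (one_div_lt_one_div_of_lt hw hwa)
  rw [dt_eq_tpow ha, dt_eq_tpow (by positivity), dt_eq_tpow hw, ← tpow_add,
    ← Real.toNNReal_add (by positivity) (by rw [one_div_one_div]; exact h0.le), one_div_one_div]
  congr 2
  ring

theorem dt_eq_zero {a : ℝ} (h : a < 1) : dt a = 0 := dif_neg (not_le.2 h)

/-! ### Limits of representatives -/

/-- The representatives of `x` tend to `r` as `t → 0⁺`. -/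
def HasLimit (x : FermatReal) (r : ℝ) : Prop :=
  ∃ u : littleOhPoly, toFermat u = x ∧ Tendsto (u : ℝ≥0 → ℝ) (𝓝[>] 0) (𝓝 r)

theorem exists_rep (x : FermatReal) : ∃ u : littleOhPoly, toFermat u = x :=
  Ideal.Quotient.mk_surjective x

/-- Two representatives differ by `o(t)`, which tends to zero. -/
theorem HasLimit.tendsto {x : FermatReal} {r : ℝ} (h : HasLimit x r) {u : littleOhPoly}
    (hu : toFermat u = x) : Tendsto (u : ℝ≥0 → ℝ) (𝓝[>] 0) (𝓝 r) := by
  obtain ⟨v, rfl, hv⟩ := h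
  have h1 := (toFermat_eq_iff.1 hu).isBigO.trans_tendsto tendsto_coe_zero
  simpa using h1.add hv

theorem HasLimit.add {x y : FermatReal} {r s : ℝ} (hx : HasLimit x r) (hy : HasLimit y s) :
    HasLimit (x + y) (r + s) := by
  obtain ⟨u, rfl, hu⟩ := hx
  obtain ⟨v, rfl, hv⟩ := hy
  exact ⟨u + v, map_add _ _ _, hu.add hv⟩

theorem HasLimit.smul {x : FermatReal} {r : ℝ} (k : ℝ) (hx : HasLimit x r) :
    HasLimit (k • x) (k * r) := by
  obtain ⟨u, rfl, hu⟩ := hx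
  exact ⟨k • u, map_smul _ _ _, hu.const_mul k⟩

theorem hasLimit_algebraMap (r : ℝ) : HasLimit (algebraMap ℝ FermatReal r) r :=
  ⟨algebraMap ℝ littleOhPoly r, AlgHom.commutes _ _, tendsto_const_nhds⟩

theorem hasLimit_zero : HasLimit 0 0 := by
  simpa using hasLimit_algebraMap 0

theorem hasLimit_dt (a : ℝ) : HasLimit (dt a) 0 := by
  by_cases h : 1 ≤ a
  · rw [dt, dif_pos h]
    refine ⟨_, rfl, ?_⟩
    simpa using tendsto_rpow_zero (one_div_pos.2 (zero_lt_one.trans_le h))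
  · rw [dt, dif_neg h]
    exact hasLimit_zero

theorem hasLimit_sum_smul_dt (s : Finset ℝ) (c d : ℝ → ℝ) :
    HasLimit (∑ w ∈ s, c w • dt (d w)) 0 := by
  classical
  induction s using Finset.induction_on with
  | empty => simpa using hasLimit_zero
  | insert w s hw ih =>
    rw [Finset.sum_insert hw]
    simpa using ((hasLimit_dt (d w)).smul (c w)).add ih

theorem hasLimit_stdPart (x : FermatReal) : HasLimit x (stdPart x) := by
  have h := (isDecomposition_coeffs x).2
  have h1 := (hasLimit_algebraMap (stdPart x)).add
    (hasLimit_sum_smul_dt (coeffs x).support (coeffs x) id)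
  rw [add_zero] at h1
  exact (congrArg (HasLimit · (stdPart x)) h).mpr h1

/-! ### Natural powers of infinitesimals -/

theorem HasExtValue.unique {f : ℝ → ℝ} {A : Set ℝ} {x y z : FermatReal}
    (hy : HasExtValue f A x y) (hz : HasExtValue f A x z) : y = z := by
  obtain ⟨u, hu, huA⟩ := hy.1
  obtain ⟨_, rfl⟩ := hy.2 u hu huA
  obtain ⟨_, rfl⟩ := hz.2 u hu huA
  rfl

theorem HasExtValue.ext_eq {f : ℝ → ℝ} {A : Set ℝ} {x y : FermatReal}
    (hy : HasExtValue f A x y) : ext f A x = y := by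
  have h : ∃ y, HasExtValue f A x y := ⟨y, hy⟩
  rw [ext, dif_pos h]
  exact h.choose_spec.unique hy

/-- The positive limit keeps representatives in the domain, where the real power with natural
exponent is the pointwise ring power. -/
theorem ext_rpow_natCast {x : FermatReal} {r : ℝ} (hx : HasLimit x r) (hr : 0 < r) (j : ℕ) :
    ext (fun s => s ^ (j : ℝ)) (Ioi 0) x = x ^ j := by
  refine HasExtValue.ext_eq ⟨?_, ?_⟩
  · obtain ⟨u, hu, hlim⟩ := hx
    exact ⟨u, hu, hlim.eventually (lt_mem_nhds hr)⟩
  · rintro u rfl -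
    have h : (fun t => (u : ℝ≥0 → ℝ) t ^ (j : ℝ)) = ((u ^ j : littleOhPoly) : ℝ≥0 → ℝ) := by
      ext t
      simp
    refine ⟨h ▸ (u ^ j).2, ?_⟩
    rw [← map_pow]
    congr 1
    exact Subtype.ext h

theorem realPow_natCast (x : ℝ) {j : ℕ} : realPow x j = x ^ j := by
  have h0 : ((j : ℝ)) = ((j : ℕ) : ℝ) / ((1 : ℕ) : ℝ) := by simp
  rcases lt_or_ge x 0 with hx | hx
  · have habs : |x| = -x := abs_of_neg hx
    rcases Nat.even_or_odd j with hj | hj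
    · rw [realPow, if_neg, Real.rpow_natCast, hj.pow_abs]
      -- An even `j` is never a quotient of odd numbers: `j * q = m` would be even.
      rintro ⟨-, m, q, hm, hq, h⟩
      have hq0 : (q : ℝ) ≠ 0 := by exact_mod_cast hq.pos.ne'
      rw [eq_div_iff hq0] at h
      have h' : j * q = m := by exact_mod_cast h
      exact Nat.not_even_iff_odd.2 hm (h' ▸ hj.mul_right q)
    · rw [realPow, if_pos ⟨hx, j, 1, hj, odd_one, h0⟩, Real.rpow_natCast, habs, hj.neg_pow, neg_neg]
  · rw [realPow, if_neg fun h => hx.not_gt h.1, Real.rpow_natCast, abs_of_nonneg hx]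

/-! ### Factoring out the leading term of an infinitesimal. -/

section Infinitesimal

variable {h : FermatReal}

theorem support_nonempty (hs : stdPart h = 0) (h0 : h ≠ 0) : (coeffs h).support.Nonempty := by
  rw [Finsupp.support_nonempty_iff]
  intro hc
  refine h0 ?_
  rw [(isDecomposition_coeffs h).2, hs, hc]
  simp

theorem order_mem_support (hs : stdPart h = 0) (h0 : h ≠ 0) : order h ∈ (coeffs h).support := by
  rw [order, dif_pos (support_nonempty hs h0)]
  exact Finset.max'_mem _ _

theorem one_le_order (hs : stdPart h = 0) (h0 : h ≠ 0) : 1 ≤ order h :=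
  (isDecomposition_coeffs h).1 _ (order_mem_support hs h0)

theorem le_order {w : ℝ} (hw : w ∈ (coeffs h).support) : w ≤ order h := by
  rw [order, dif_pos ⟨w, hw⟩]
  exact Finset.le_max' _ _ hw

-- This is the factorization on which `infPow` is modelled; raising it to the power `j` yields both
-- `infPow_natCast` and the nilpotency of `h`.
open Classical in
theorem eq_leading_mul (hs : stdPart h = 0) (h0 : h ≠ 0) :
    h = coeffs h (order h) • (dt (order h) *
      (1 + ∑ w ∈ (coeffs h).support.erase (order h),
        (coeffs h w / coeffs h (order h)) • dt (1 / (1 / w - 1 / order h)))) := by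
  have hm := order_mem_support hs h0
  have hc := Finsupp.mem_support_iff.1 hm
  conv_lhs => rw [(isDecomposition_coeffs h).2, hs, map_zero, zero_add, Finsupp.sum,
    ← Finset.add_sum_erase _ _ hm]
  rw [mul_add, smul_add, mul_one, Finset.mul_sum, Finset.smul_sum]
  congr 1
  refine Finset.sum_congr rfl fun w hw => ?_
  have hw' := Finset.mem_of_mem_erase hw
  have hlt : w < order h := lt_of_le_of_ne (le_order hw') (Finset.ne_of_mem_erase hw)
  have hw0 : 0 < w := zero_lt_one.trans_le ((isDecomposition_coeffs h).1 w hw')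
  rw [mul_smul_comm, dt_mul_dt hw0 hlt, smul_smul, mul_div_cancel₀ _ hc]

theorem infPow_natCast (hs : stdPart h = 0) (j : ℕ) : infPow h j = h ^ j := by
  classical
  rw [infPow]
  rcases eq_or_ne j 0 with rfl | hj
  · simp
  rw [if_neg (by exact_mod_cast hj)]
  by_cases h0 : h = 0
  · rw [if_pos h0, h0, zero_pow hj]
  have hlim : HasLimit (1 + ∑ w ∈ (coeffs h).support.erase (order h),
      (coeffs h w / coeffs h (order h)) • dt (1 / (1 / w - 1 / order h))) 1 := by
    simpa using (hasLimit_algebraMap 1).add (hasLimit_sum_smul_dt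
      ((coeffs h).support.erase (order h)) (fun w => coeffs h w / coeffs h (order h))
      (fun w => 1 / (1 / w - 1 / order h)))
  rw [if_neg h0, ext_rpow_natCast hlim one_pos, realPow_natCast,
    dt_div_nat (zero_lt_one.trans_le (one_le_order hs h0)) hj]
  conv_rhs => rw [eq_leading_mul hs h0]
  rw [smul_pow, mul_pow]

/-- The factor `dt (order h) ^ j = dt (order h / j)` of the power has index below `1`, hence is
zero. -/
theorem pow_eq_zero_of_order_lt (hs : stdPart h = 0) {j : ℕ} (hj : j ≠ 0) (hlt : order h < j) :
    h ^ j = 0 := by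
  classical
  by_cases h0 : h = 0
  · rw [h0, zero_pow hj]
  have hj0 : (0 : ℝ) < j := by positivity
  rw [eq_leading_mul hs h0, smul_pow, mul_pow,
    ← dt_div_nat (zero_lt_one.trans_le (one_le_order hs h0)) hj,
    dt_eq_zero ((div_lt_one hj0).2 hlt), zero_mul, smul_zero]

end Infinitesimal

/-! ### Extension by Taylor polynomials -/

/-- A function with a Taylor expansion at `a` within `A` extends to `a + h` when the order of the
expansion exceeds the order of the infinitesimal `h`. -/
theorem hasExtValue_of_isLittleO {f : ℝ → ℝ} {A : Set ℝ} {a : ℝ} {M : ℕ} {c : ℕ → ℝ}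
    (hf : (fun x => f x - ∑ j ∈ Finset.range (M + 1), c j * (x - a) ^ j) =o[𝓝[A] a]
      fun x => (x - a) ^ M)
    {h : FermatReal} (hs : stdPart h = 0) (hM : h ^ M = 0)
    (hex : ∃ v : littleOhPoly, toFermat v = h ∧
      ∀ᶠ t in 𝓝[>] (0 : ℝ≥0), a + (v : ℝ≥0 → ℝ) t ∈ A) :
    HasExtValue f A (algebraMap ℝ FermatReal a + h)
      (∑ j ∈ Finset.range (M + 1), c j • h ^ j) := by
  constructor
  · obtain ⟨v, rfl, hv⟩ := hex
    refine ⟨algebraMap ℝ littleOhPoly a + v, ?_, hv⟩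
    rw [map_add, AlgHom.commutes]
  · intro u hu huA
    set w : littleOhPoly := u - algebraMap ℝ littleOhPoly a with hw
    have hwt : ∀ t, (w : ℝ≥0 → ℝ) t = (u : ℝ≥0 → ℝ) t - a := fun t => rfl
    have hwh : toFermat w = h := by rw [hw, map_sub, AlgHom.commutes, hu]; ring
    have hw0 : Tendsto (w : ℝ≥0 → ℝ) (𝓝[>] 0) (𝓝 0) := hs ▸ (hasLimit_stdPart h).tendsto hwh
    have hua : Tendsto (u : ℝ≥0 → ℝ) (𝓝[>] 0) (𝓝[A] a) := by
      refine tendsto_nhdsWithin_iff.2 ⟨?_, huA⟩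
      have := hw0.add_const a
      simp only [hwt, zero_add, sub_add_cancel] at this
      exact this
    -- Nilpotency, read on representatives, turns the remainder `o((x - a) ^ M)` into `o(t)`.
    have hpow : (fun t => (w : ℝ≥0 → ℝ) t ^ M) =o[𝓝[>] 0] (fun t : ℝ≥0 => (t : ℝ)) := by
      have h1 : toFermat (w ^ M) = toFermat 0 := by rw [map_pow, hwh, hM, map_zero]
      simpa using toFermat_eq_iff.1 h1
    let p : littleOhPoly := ∑ j ∈ Finset.range (M + 1), c j • w ^ j
    have hp : ∀ t, (p : ℝ≥0 → ℝ) t =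
        ∑ j ∈ Finset.range (M + 1), c j * ((u : ℝ≥0 → ℝ) t - a) ^ j := by
      intro t
      simp [p, Finset.sum_apply, hwt]
    have hmain : (fun t => f ((u : ℝ≥0 → ℝ) t) - (p : ℝ≥0 → ℝ) t) =o[𝓝[>] 0]
        (fun t : ℝ≥0 => (t : ℝ)) := by
      simp only [hp]
      exact (hf.comp_tendsto hua).trans hpow
    refine ⟨IsLittleOhPoly.of_isLittleO p.2 hmain, ?_⟩
    have h2 : toFermat p = ∑ j ∈ Finset.range (M + 1), c j • h ^ j := by
      simp only [p, map_sum, map_smul, map_pow, hwh]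
    rw [← h2]
    exact toFermat_eq_iff.2 hmain

theorem exists_nonneg_rep {h : FermatReal} (h0 : 0 ≤ h) :
    ∃ v : littleOhPoly, toFermat v = h ∧ ∀ᶠ t in 𝓝[>] (0 : ℝ≥0), 0 ≤ (v : ℝ≥0 → ℝ) t := by
  obtain ⟨u, v, hu, hv, huv⟩ := h0
  refine ⟨v - u, by rw [map_sub, hu, hv, sub_zero], huv.mono fun t ht => ?_⟩
  exact sub_nonneg.2 ht

open MeasureTheory intervalIntegral

/-! ### The Beta integral -/

/-- A translation moves the integral to `[0, x - t]`, where it is a scaled complex Beta integral. -/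
theorem integral_rpow_mul_rpow {β γ t x : ℝ} (hβ : 0 < β) (hγ : 0 < γ) (htx : t < x) :
    ∫ s in t..x, (x - s) ^ (β - 1) * (s - t) ^ (γ - 1) =
      (x - t) ^ (β + γ - 1) * ProbabilityTheory.beta β γ := by
  set L := x - t with hL
  have hL0 : 0 < L := sub_pos.2 htx
  have h1 : ∫ s in t..x, (x - s) ^ (β - 1) * (s - t) ^ (γ - 1) =
      ∫ s in (0 : ℝ)..L, s ^ (γ - 1) * (L - s) ^ (β - 1) := by
    have := intervalIntegral.integral_comp_sub_right (a := t) (b := x)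
      (fun s => s ^ (γ - 1) * (L - s) ^ (β - 1)) t
    rw [sub_self] at this
    rw [← this]
    refine intervalIntegral.integral_congr fun s _ => ?_
    simp only [hL]
    rw [mul_comm]
    congr 2
    ring
  have h2 : ((∫ s in (0 : ℝ)..L, s ^ (γ - 1) * (L - s) ^ (β - 1) : ℝ) : ℂ) =
      ((L ^ (β + γ - 1) * ProbabilityTheory.beta β γ : ℝ) : ℂ) := by
    have h3 := Complex.betaIntegral_scaled (γ : ℂ) (β : ℂ) hL0
    rw [Complex.betaIntegral_eq_Gamma_mul_div _ _ (by simpa) (by simpa)] at h3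
    rw [← intervalIntegral.integral_ofReal]
    refine Eq.trans ?_ (h3.trans ?_)
    · refine intervalIntegral.integral_congr fun s hs => ?_
      rw [uIcc_of_le hL0.le] at hs
      simp only [Complex.ofReal_mul]
      rw [Complex.ofReal_cpow hs.1, Complex.ofReal_cpow (sub_nonneg.2 hs.2)]
      push_cast
      rfl
    · rw [ProbabilityTheory.beta, ← Complex.ofReal_add, Complex.Gamma_ofReal, Complex.Gamma_ofReal,
        Complex.Gamma_ofReal, Complex.ofReal_mul, Complex.ofReal_cpow hL0.le, add_comm β γ]
      push_cast
      ring
  rw [h1]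
  exact_mod_cast h2

/-- A non-integrable function has integral `0` by convention, whereas the Beta integral is positive.
-/
theorem intervalIntegrable_rpow_mul_rpow {β γ t x : ℝ} (hβ : 0 < β) (hγ : 0 < γ) (htx : t < x) :
    IntervalIntegrable (fun s => (x - s) ^ (β - 1) * (s - t) ^ (γ - 1)) volume t x := by
  by_contra h
  have h1 := integral_rpow_mul_rpow hβ hγ htx
  rw [intervalIntegral.integral_undef h] at h1
  exact (mul_pos (Real.rpow_pos_of_pos (sub_pos.2 htx) _)
    (ProbabilityTheory.beta_pos hβ hγ)).ne h1

theorem intervalIntegrable_rpow_mul {β a x : ℝ} (hβ : 0 < β) {g : ℝ → ℝ} (hg : Continuous g) :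
    IntervalIntegrable (fun t => (x - t) ^ (β - 1) * g t) volume a x := by
  refine IntervalIntegrable.mul_continuousOn ?_ hg.continuousOn
  have h := intervalIntegral.intervalIntegrable_rpow' (a := x - a) (b := x - x)
    (r := β - 1) (by linarith)
  simpa using h.comp_sub_left x

/-! ### Riemann-Liouville integrals -/

theorem riemannLiouville_of_pos {a β : ℝ} (hβ : 0 < β) (g : ℝ → ℝ) (x : ℝ) :
    riemannLiouville a β g x = 1 / Real.Gamma β * ∫ t in a..x, (x - t) ^ (β - 1) * g t :=
  if_neg hβ.ne'

theorem riemannLiouville_congr {a b β x : ℝ} {g k : ℝ → ℝ} (h : EqOn g k (Ioc a b))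
    (hx : x ∈ Ioc a b) : riemannLiouville a β g x = riemannLiouville a β k x := by
  rw [riemannLiouville, riemannLiouville, h hx, integral_of_le hx.1.le, integral_of_le hx.1.le,
    setIntegral_congr_fun measurableSet_Ioc fun t ht => ?_]
  simp only [h ⟨ht.1, ht.2.trans hx.2⟩]

theorem riemannLiouville_self {a β : ℝ} (hβ : 0 < β) (g : ℝ → ℝ) :
    riemannLiouville a β g a = 0 := by
  rw [riemannLiouville_of_pos hβ, integral_same, mul_zero]

theorem riemannLiouville_one {a : ℝ} (g : ℝ → ℝ) (x : ℝ) :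
    riemannLiouville a 1 g x = ∫ t in a..x, g t := by
  rw [riemannLiouville_of_pos one_pos]
  simp

/-- The substitution `t = a + (x - a) * s` frees both the singular kernel and the domain from `x`,
which makes dominated convergence applicable in `continuousOn_riemannLiouville`. -/
theorem riemannLiouville_eq_integral_unit {a β x : ℝ} (hβ : 0 < β) (hx : a ≤ x) (g : ℝ → ℝ) :
    riemannLiouville a β g x = 1 / Real.Gamma β *
      ((x - a) ^ β * ∫ s in (0 : ℝ)..1, (1 - s) ^ (β - 1) * g (a + (x - a) * s)) := by
  rw [riemannLiouville_of_pos hβ]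
  rcases hx.eq_or_lt with rfl | hx
  · simp [Real.zero_rpow hβ.ne']
  have hL : 0 < x - a := sub_pos.2 hx
  have h := intervalIntegral.mul_integral_comp_add_mul (a := 0) (b := 1)
    (f := fun t => (x - t) ^ (β - 1) * g t) (x - a) a
  simp only [mul_zero, add_zero, mul_one, add_sub_cancel] at h
  rw [← h, ← intervalIntegral.integral_const_mul (x - a),
    ← intervalIntegral.integral_const_mul ((x - a) ^ β)]
  congr 1
  refine intervalIntegral.integral_congr fun s hs => ?_
  rw [uIcc_of_le zero_le_one] at hs
  have h1 : x - (a + (x - a) * s) = (x - a) * (1 - s) := by ring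
  rw [h1, Real.mul_rpow hL.le (sub_nonneg.2 hs.2), ← mul_assoc, ← mul_assoc, ← mul_assoc]
  congr 2
  rw [← Real.rpow_one_add' hL.le (by simpa using hβ.ne')]
  congr 1
  ring

/-- Every continuous function on a compact interval has a bounded continuous extension. -/
theorem exists_continuous_extension {a b : ℝ} (hab : a ≤ b) {g : ℝ → ℝ}
    (hg : ContinuousOn g (Icc a b)) :
    ∃ k : ℝ → ℝ, Continuous k ∧ EqOn g k (Icc a b) ∧ ∃ C, ∀ x, ‖k x‖ ≤ C := by
  refine ⟨IccExtend hab ((Icc a b).domRestrict g), hg.domRestrict.Icc_extend', fun x hx => ?_, ?_⟩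
  · rw [IccExtend_of_mem _ _ hx]; rfl
  · obtain ⟨C, hC⟩ := isCompact_Icc.exists_bound_of_continuousOn hg
    exact ⟨C, fun x => hC _ (projIcc a b hab x).2⟩

theorem continuousOn_riemannLiouville {a b β : ℝ} (hab : a ≤ b) (hβ : 0 < β) {g : ℝ → ℝ}
    (hg : ContinuousOn g (Icc a b)) : ContinuousOn (riemannLiouville a β g) (Icc a b) := by
  obtain ⟨k, hk, hgk, C, hC⟩ := exists_continuous_extension hab hg
  have h1 : Continuous fun x : ℝ => ∫ s in (0 : ℝ)..1, (1 - s) ^ (β - 1) * k (a + (x - a) * s) := by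
    refine intervalIntegral.continuous_of_dominated_interval
      (bound := fun s => ‖(1 - s) ^ (β - 1)‖ * C) (fun x => ?_) (fun x => ?_) ?_ ?_
    · refine AEStronglyMeasurable.mul ?_ (by fun_prop)
      exact (Measurable.pow_const (by fun_prop) _).aestronglyMeasurable
    · refine Eventually.of_forall fun s _ => ?_
      rw [norm_mul]
      exact mul_le_mul_of_nonneg_left (hC _) (norm_nonneg _)
    · have := (intervalIntegrable_rpow_mul (a := 0) (x := 1) hβ
        (continuous_const (y := (1 : ℝ)))).norm.mul_const C
      simpa using this
    · refine Eventually.of_forall fun s _ => ?_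
      fun_prop
  have h2 : ContinuousOn (fun x => 1 / Real.Gamma β *
      ((x - a) ^ β * ∫ s in (0 : ℝ)..1, (1 - s) ^ (β - 1) * k (a + (x - a) * s))) (Icc a b) := by
    refine Continuous.continuousOn (continuous_const.mul (Continuous.mul ?_ h1))
    exact (continuous_id.sub continuous_const).rpow_const fun x => Or.inr hβ.le
  refine h2.congr fun x hx => ?_
  simp only
  rw [← riemannLiouville_eq_integral_unit hβ hx.1]
  rcases hx.1.eq_or_lt with rfl | hx1
  · rw [riemannLiouville_self hβ, riemannLiouville_self hβ]
  · exact riemannLiouville_congr (hgk.mono Ioc_subset_Icc_self) ⟨hx1, hx.2⟩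

/-- With this normalization the factors of the Beta function cancel, and integration of order `β`
only shifts the exponent. -/
theorem riemannLiouville_rpow {a β γ x : ℝ} (hβ : 0 ≤ β) (hγ : 0 < γ) (hx : a < x) :
    riemannLiouville a β (fun t => (t - a) ^ (γ - 1) / Real.Gamma γ) x =
      (x - a) ^ (β + γ - 1) / Real.Gamma (β + γ) := by
  rcases hβ.eq_or_lt with rfl | hβ
  · simp [riemannLiouville]
  rw [riemannLiouville_of_pos hβ]
  have h1 := integral_rpow_mul_rpow hβ hγ hx
  have hΓβ := (Real.Gamma_pos_of_pos hβ).ne'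
  have hΓγ := (Real.Gamma_pos_of_pos hγ).ne'
  simp_rw [← mul_div_assoc]
  rw [intervalIntegral.integral_div, h1, ProbabilityTheory.beta]
  field_simp

/-- Exchange of the order of integration for a product of two kernels of power type. -/
theorem integral_rpow_mul_integral_rpow {a x β γ : ℝ} (hβ : 0 < β) (hγ : 0 < γ) (hx : a < x)
    {k : ℝ → ℝ} (hk : Continuous k) :
    ∫ s in a..x, (x - s) ^ (β - 1) * ∫ t in a..s, (s - t) ^ (γ - 1) * k t =
      ProbabilityTheory.beta β γ * ∫ t in a..x, (x - t) ^ (β + γ - 1) * k t := by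
  set μ := (volume : Measure ℝ).restrict (Ioc a x) with hμ
  -- The integrand on the triangle `t < s`, extended by zero to the square, so that Fubini applies
  -- to a product measure.
  let F : ℝ → ℝ → ℝ := fun s t =>
    (Iio s).indicator (fun t => (x - s) ^ (β - 1) * ((s - t) ^ (γ - 1) * k t)) t
  have hF : ∀ s t, F s t =
      (Ioi t).indicator (fun s => (x - s) ^ (β - 1) * (s - t) ^ (γ - 1) * k t) s := by
    intro s t
    by_cases h : t < s
    · simp only [F]
      rw [indicator_of_mem (by exact h), indicator_of_mem (by exact h), mul_assoc]
    · simp only [F]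
      rw [indicator_of_notMem (by exact h), indicator_of_notMem (by exact h)]
  have hleft : ∀ s ∈ Ioc a x, ∫ t, F s t ∂μ =
      (x - s) ^ (β - 1) * ∫ t in a..s, (s - t) ^ (γ - 1) * k t := by
    intro s hs
    simp only [F]
    rw [MeasureTheory.integral_indicator measurableSet_Iio, hμ,
      Measure.restrict_restrict measurableSet_Iio, integral_of_le hs.1.le,
      integral_Ioc_eq_integral_Ioo, ← MeasureTheory.integral_const_mul]
    congr 2
    ext t
    simp only [mem_inter_iff, mem_Iio, mem_Ioc, mem_Ioo]
    exact ⟨fun h => ⟨h.2.1, h.1⟩, fun h => ⟨h.2, h.1, h.2.le.trans hs.2⟩⟩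
  have hset : ∀ t ∈ Ioo a x, Ioi t ∩ Ioc a x = Ioc t x := by
    intro t ht
    ext s
    simp only [mem_inter_iff, mem_Ioi, mem_Ioc]
    exact ⟨fun h => ⟨h.1, h.2.2⟩, fun h => ⟨h.1, ht.1.trans h.1, h.2⟩⟩
  have hright : ∀ t ∈ Ioo a x, ∫ s, F s t ∂μ =
      ProbabilityTheory.beta β γ * ((x - t) ^ (β + γ - 1) * k t) := by
    intro t ht
    simp_rw [hF]
    rw [MeasureTheory.integral_indicator measurableSet_Ioi, hμ,
      Measure.restrict_restrict measurableSet_Ioi, hset t ht, MeasureTheory.integral_mul_const, ← integral_of_le ht.2.le,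
      integral_rpow_mul_rpow hβ hγ ht.2]
    ring
  -- Both kernels are nonnegative on the triangle, so taking norms only replaces `k t` by `|k t|`;
  -- this gives the integrability needed for Fubini.
  have hright' : ∀ t ∈ Ioo a x, ∫ s, ‖F s t‖ ∂μ =
      ProbabilityTheory.beta β γ * ((x - t) ^ (β + γ - 1) * |k t|) := by
    intro t ht
    simp_rw [hF, norm_indicator_eq_indicator_norm]
    rw [MeasureTheory.integral_indicator measurableSet_Ioi, hμ,
      Measure.restrict_restrict measurableSet_Ioi, hset t ht]
    have h1 : ∫ s in Ioc t x, ‖(x - s) ^ (β - 1) * (s - t) ^ (γ - 1) * k t‖ =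
        ∫ s in Ioc t x, (x - s) ^ (β - 1) * (s - t) ^ (γ - 1) * |k t| := by
      refine setIntegral_congr_fun measurableSet_Ioc fun s hs => ?_
      simp only [norm_mul, Real.norm_eq_abs]
      rw [abs_of_nonneg (Real.rpow_nonneg (sub_nonneg.2 hs.2) _),
        abs_of_nonneg (Real.rpow_nonneg (sub_nonneg.2 hs.1.le) _)]
    rw [h1, MeasureTheory.integral_mul_const, ← integral_of_le ht.2.le,
      integral_rpow_mul_rpow hβ hγ ht.2]
    ring
  have hae : ∀ᵐ t ∂μ, t ∈ Ioo a x := by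
    rw [hμ, ← restrict_Ioo_eq_restrict_Ioc]
    exact ae_restrict_mem measurableSet_Ioo
  have hmeas : Measurable (Function.uncurry F) := by
    have h1 : Function.uncurry F = {p : ℝ × ℝ | p.2 < p.1}.indicator
        (fun p => (x - p.1) ^ (β - 1) * ((p.1 - p.2) ^ (γ - 1) * k p.2)) := by
      ext ⟨s, t⟩
      by_cases h : t < s
      · simp [Function.uncurry, F, h]
      · simp [Function.uncurry, F, h]
    rw [h1]
    refine Measurable.indicator ?_ (measurableSet_lt measurable_snd measurable_fst)
    have := hk.measurable
    fun_prop
  have hint : Integrable (Function.uncurry F) (μ.prod μ) := by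
    rw [integrable_prod_iff' hmeas.aestronglyMeasurable]
    constructor
    · filter_upwards [hae] with t ht
      simp only [Function.uncurry, hF]
      rw [integrable_indicator_iff measurableSet_Ioi, IntegrableOn, hμ,
        Measure.restrict_restrict measurableSet_Ioi, hset t ht]
      exact ((intervalIntegrable_iff_integrableOn_Ioc_of_le ht.2.le).1
        (intervalIntegrable_rpow_mul_rpow hβ hγ ht.2)).mul_const _
    · have h1 : Integrable (fun t => ProbabilityTheory.beta β γ *
          ((x - t) ^ (β + γ - 1) * |k t|)) μ :=
        ((intervalIntegrable_iff_integrableOn_Ioc_of_le hx.le).1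
          (intervalIntegrable_rpow_mul (add_pos hβ hγ) hk.abs)).const_mul _
      refine h1.congr ?_
      filter_upwards [hae] with t ht
      exact (hright' t ht).symm
  have hswap := integral_integral_swap hint
  rw [integral_of_le hx.le, integral_of_le hx.le, ← MeasureTheory.integral_const_mul]
  refine Eq.trans ?_ (hswap.trans ?_)
  · exact (setIntegral_congr_fun measurableSet_Ioc hleft).symm
  · refine integral_congr_ae ?_
    filter_upwards [hae] with t ht
    exact hright t ht

/-- The semigroup property of the Riemann-Liouville integrals. -/
theorem riemannLiouville_riemannLiouville {a b x β γ : ℝ} (hβ : 0 ≤ β) (hγ : 0 < γ)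
    (hx : x ∈ Ioc a b) {g : ℝ → ℝ} (hg : ContinuousOn g (Icc a b)) :
    riemannLiouville a β (riemannLiouville a γ g) x = riemannLiouville a (β + γ) g x := by
  rcases hβ.eq_or_lt with rfl | hβ
  · rw [zero_add]; exact if_pos rfl
  obtain ⟨k, hk, hgk, -⟩ := exists_continuous_extension (hx.1.le.trans hx.2) hg
  have hgk' : EqOn g k (Ioc a b) := hgk.mono Ioc_subset_Icc_self
  have h1 : EqOn (riemannLiouville a γ g) (riemannLiouville a γ k) (Ioc a b) :=
    fun s hs => riemannLiouville_congr hgk' hs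
  rw [riemannLiouville_congr h1 hx, riemannLiouville_congr hgk' hx, riemannLiouville_of_pos hβ,
    riemannLiouville_of_pos (add_pos hβ hγ)]
  simp_rw [riemannLiouville_of_pos hγ, mul_left_comm _ (1 / Real.Gamma γ)]
  rw [intervalIntegral.integral_const_mul, integral_rpow_mul_integral_rpow hβ hγ hx.1 hk,
    ProbabilityTheory.beta]
  have hΓβ := (Real.Gamma_pos_of_pos hβ).ne'
  have hΓγ := (Real.Gamma_pos_of_pos hγ).ne'
  field_simp

/-- By the semigroup property the function is the ordinary integral of the continuous
`riemannLiouville a γ g`; the fundamental theorem of calculus does the rest. -/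
theorem hasDerivWithinAt_riemannLiouville_add_one {a b x γ : ℝ} (hγ : 0 < γ)
    (hx : x ∈ Ioc a b) {g : ℝ → ℝ} (hg : ContinuousOn g (Icc a b)) :
    HasDerivWithinAt (riemannLiouville a (γ + 1) g) (riemannLiouville a γ g x) (Icc a b) x := by
  have hab := hx.1.le.trans hx.2
  obtain ⟨k, hk, hgk, -⟩ :=
    exists_continuous_extension hab (continuousOn_riemannLiouville hab hγ hg)
  have h1 := (hk.integral_hasStrictDerivAt a x).hasDerivAt.hasDerivWithinAt (s := Icc a b)
  have hxI : x ∈ Icc a b := Ioc_subset_Icc_self hx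
  rw [hgk hxI]
  have h2 : EqOn (riemannLiouville a (γ + 1) g) (fun u => ∫ y in a..u, k y) (Icc a b) := by
    intro y hy
    rcases hy.1.eq_or_lt with rfl | hy1
    · rw [riemannLiouville_self (by linarith)]
      exact integral_same.symm
    · have hy' : y ∈ Ioc a b := ⟨hy1, hy.2⟩
      rw [add_comm, ← riemannLiouville_riemannLiouville zero_le_one hγ hy' hg,
        riemannLiouville_congr (hgk.mono Ioc_subset_Icc_self) hy', riemannLiouville_one]
  exact h1.congr h2 (h2 hxI)

/-- Integration by parts: expansion of a Riemann-Liouville integral to first order at `a`. -/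
theorem riemannLiouville_eq_add {a b x δ : ℝ} (hδ : 0 < δ) (hx : x ∈ Ioc a b) {g g' : ℝ → ℝ}
    (hg : ContinuousOn g (Icc a b)) (hg' : ContinuousOn g' (Icc a b))
    (hd : ∀ y ∈ Icc a b, HasDerivWithinAt g (g' y) (Icc a b) y) :
    riemannLiouville a δ g x =
      g a * ((x - a) ^ δ / Real.Gamma (δ + 1)) + riemannLiouville a (δ + 1) g' x := by
  have hab := hx.1.trans_le hx.2
  have hJ := continuousOn_riemannLiouville hab.le one_pos hg'
  -- Instead of integrating by parts, apply the operator of order `δ` to this identity: the constant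
  -- `1` is the normalized power with `γ = 1`, and the semigroup property treats the integral.
  have h1 : EqOn g (fun y => g a * 1 + riemannLiouville a 1 g' y) (Ioc a b) := by
    intro y hy
    have hsub : Icc a y ⊆ Icc a b := Icc_subset_Icc_right hy.2
    have h2 := integral_eq_sub_of_hasDeriv_right_of_le (f := g) (f' := g') hy.1.le (hg.mono hsub)
      (fun z hz => ((hd z (hsub (Ioo_subset_Icc_self hz))).hasDerivAt
        (Icc_mem_nhds hz.1 (hz.2.trans_le hy.2))).hasDerivWithinAt)
      ((hg'.mono hsub).intervalIntegrable_of_Icc hy.1.le)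
    simp only
    rw [riemannLiouville_one, h2]
    ring
  have h3 := riemannLiouville_rpow (a := a) hδ.le one_pos hx.1
  have h4 := riemannLiouville_riemannLiouville hδ.le one_pos hx hg'
  obtain ⟨k, hk, hJk, -⟩ := exists_continuous_extension hab.le hJ
  have hJk' := hJk.mono (Ioc_subset_Icc_self (a := a))
  rw [riemannLiouville_congr h1 hx, ← h4, riemannLiouville_congr hJk' hx]
  rw [riemannLiouville_congr (k := fun y => g a * 1 + k y)
    (fun y hy => by simp only [hJk' hy]) hx]
  simp only [sub_self, Real.rpow_zero, Real.Gamma_one, div_one, add_sub_cancel_right] at h3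
  rw [← h3]
  simp_rw [riemannLiouville_of_pos hδ, mul_add]
  rw [integral_add (intervalIntegrable_rpow_mul hδ continuous_const)
    (intervalIntegrable_rpow_mul hδ hk)]
  simp_rw [mul_left_comm _ (g a)]
  rw [intervalIntegral.integral_const_mul]
  ring

/-! ### Caputo derivatives and expansions at the base point -/

theorem ceil_eq_one {α : ℝ} (hα : 0 < α) (hα1 : α ≤ 1) : ⌈α⌉₊ = 1 := by
  rw [Nat.ceil_eq_iff one_ne_zero]
  simpa using ⟨hα, hα1⟩

theorem caputo_of_ne {a b α x : ℝ} (hα : 0 < α) (hα1 : α ≤ 1) (g : ℝ → ℝ) (hx : x ≠ a) :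
    caputo a b α g x = riemannLiouville a (1 - α) (derivWithin g (Icc a b)) x := by
  rw [caputo, if_neg hx, ceil_eq_one hα hα1, iteratedDerivWithin_one, Nat.cast_one]

/-- The Caputo derivative of a function given by its expansion at the base point. -/
theorem caputo_of_eqOn {a b α γ c A x : ℝ} (hα : 0 < α) (hα1 : α ≤ 1) (hγ : 0 < γ)
    {g ψ : ℝ → ℝ} (hψ : ContinuousOn ψ (Icc a b))
    (hg : ∀ y ∈ Ioc a b, g y = c + A * ((y - a) ^ γ / Real.Gamma (γ + 1)) +
      riemannLiouville a (γ + 1) ψ y) (hx : x ∈ Ioc a b) :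
    caputo a b α g x = A * ((x - a) ^ (γ - α) / Real.Gamma (γ - α + 1)) +
      riemannLiouville a (γ + 1 - α) ψ x := by
  have hab : a < b := hx.1.trans_le hx.2
  have hβ : 0 ≤ 1 - α := by linarith
  -- Differentiation lowers all orders by `1`, and integration of order `1 - α` then raises them by
  -- `1 - α`. The point `a` is excluded, as `(y - a) ^ γ` may fail to be differentiable there.
  have hderiv : ∀ y ∈ Ioc a b, derivWithin g (Icc a b) y =
      A * ((y - a) ^ (γ - 1) / Real.Gamma γ) + riemannLiouville a γ ψ y := by
    intro y hy
    have hy0 : 0 < y - a := sub_pos.2 hy.1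
    have h1 : HasDerivAt (fun y => (y - a) ^ γ) (γ * (y - a) ^ (γ - 1)) y := by
      simpa using ((hasDerivAt_id y).sub_const a).rpow_const (p := γ) (Or.inl hy0.ne')
    have h2 := ((((h1.div_const (Real.Gamma (γ + 1))).const_mul A).const_add c).hasDerivWithinAt
      (s := Icc a b)).add (hasDerivWithinAt_riemannLiouville_add_one hγ hy hψ)
    have h3 : g =ᶠ[𝓝[Icc a b] y] fun y => c + A * ((y - a) ^ γ / Real.Gamma (γ + 1)) +
        riemannLiouville a (γ + 1) ψ y := by
      filter_upwards [self_mem_nhdsWithin, mem_nhdsWithin_of_mem_nhds (lt_mem_nhds hy.1)]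
        with z hz hz'
      exact hg z ⟨hz', hz.2⟩
    have hy' : y ∈ Icc a b := Ioc_subset_Icc_self hy
    refine ((h2.congr_of_eventuallyEq h3 (hg y hy)).derivWithin
      (uniqueDiffOn_Icc hab y hy')).trans ?_
    rw [Real.Gamma_add_one hγ.ne', mul_div_mul_left _ _ hγ.ne']
  obtain ⟨k, hk, hJk, -⟩ :=
    exists_continuous_extension hab.le (continuousOn_riemannLiouville hab.le hγ hψ)
  have hJk' := hJk.mono (Ioc_subset_Icc_self (a := a))
  have e1 : γ + 1 - α = 1 - α + γ := by ring
  have e2 : 1 - α + γ - 1 = γ - α := by ring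
  have e3 : 1 - α + γ = γ - α + 1 := by ring
  rw [caputo_of_ne hα hα1 g hx.1.ne', riemannLiouville_congr hderiv hx, e1,
    ← riemannLiouville_riemannLiouville hβ hγ hx hψ]
  have h1 := riemannLiouville_rpow hβ hγ hx.1
  rw [e2, e3] at h1
  rw [← h1]
  -- For `α = 1` the outer operator is the identity.
  rcases hβ.eq_or_lt with h0 | hβ
  · simp [riemannLiouville, ← h0]
  rw [riemannLiouville_congr hJk' hx, riemannLiouville_congr
    (k := fun y => A * ((y - a) ^ (γ - 1) / Real.Gamma γ) + k y)
    (fun y hy => by simp only [hJk' hy]) hx]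
  simp_rw [riemannLiouville_of_pos hβ, mul_add]
  have hint : IntervalIntegrable
      (fun t => (x - t) ^ (1 - α - 1) * (A * ((t - a) ^ (γ - 1) / Real.Gamma γ)))
      MeasureTheory.volume a x := by
    refine ((intervalIntegrable_rpow_mul_rpow hβ hγ hx.1).mul_const
      (A / Real.Gamma γ)).congr fun t _ => ?_
    ring
  rw [intervalIntegral.integral_add hint (intervalIntegrable_rpow_mul hβ hk)]
  simp_rw [mul_left_comm _ A]
  rw [intervalIntegral.integral_const_mul]
  ring

section Limits

variable {a b δ ε c A : ℝ} {g ψ : ℝ → ℝ}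

theorem tendsto_riemannLiouville (hab : a < b) (hε : 0 < ε) (hψ : ContinuousOn ψ (Icc a b)) :
    Tendsto (riemannLiouville a ε ψ) (𝓝[>] a) (𝓝 0) := by
  have h := continuousOn_riemannLiouville hab.le hε hψ a (left_mem_Icc.2 hab.le)
  rw [ContinuousWithinAt, riemannLiouville_self hε] at h
  rw [← nhdsWithin_Ioc_eq_nhdsGT hab]
  exact h.mono_left (nhdsWithin_mono _ Ioc_subset_Icc_self)

theorem tendsto_sub_rpow (hδ : 0 < δ) : Tendsto (fun x => (x - a) ^ δ) (𝓝[>] a) (𝓝 0) := by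
  have h : Tendsto (fun x => (x - a) ^ δ) (𝓝 a) (𝓝 ((a - a) ^ δ)) :=
    ((continuous_id.sub continuous_const).rpow_const fun x => Or.inr hδ.le).tendsto a
  rw [sub_self, Real.zero_rpow hδ.ne'] at h
  exact h.mono_left nhdsWithin_le_nhds

theorem tendsto_nhdsGT_of_continuousOn (hab : a < b) (hgc : ContinuousOn g (Icc a b)) :
    Tendsto g (𝓝[>] a) (𝓝 (g a)) := by
  rw [← nhdsWithin_Ioc_eq_nhdsGT hab]
  exact (hgc a (left_mem_Icc.2 hab.le)).mono_left (nhdsWithin_mono _ Ioc_subset_Icc_self)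

theorem apply_eq_of_expansion (hab : a < b) (hδ : 0 < δ) (hε : 0 < ε)
    (hψ : ContinuousOn ψ (Icc a b)) (hgc : ContinuousOn g (Icc a b))
    (hg : ∀ y ∈ Ioc a b, g y = c + A * ((y - a) ^ δ / Real.Gamma (δ + 1)) +
      riemannLiouville a ε ψ y) : g a = c := by
  have h1 := ((((tendsto_sub_rpow (a := a) hδ).div_const (Real.Gamma (δ + 1))).const_mul
    A).const_add c).add (tendsto_riemannLiouville hab hε hψ)
  simp only [zero_div, mul_zero, add_zero] at h1
  refine tendsto_nhds_unique (tendsto_nhdsGT_of_continuousOn hab hgc) (h1.congr' ?_)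
  filter_upwards [Ioc_mem_nhdsGT hab] with y hy
  exact (hg y hy).symm

/-- A continuous `g` cannot carry a singular term: multiplied by `(y - a) ^ (-δ)`, everything but
the constant `A / Γ(δ + 1)` tends to zero. -/
theorem coeff_eq_zero_of_expansion (hab : a < b) (hδ : δ < 0) (hδ1 : 0 < δ + 1) (hε : 0 < ε)
    (hψ : ContinuousOn ψ (Icc a b)) (hgc : ContinuousOn g (Icc a b))
    (hg : ∀ y ∈ Ioc a b, g y = A * ((y - a) ^ δ / Real.Gamma (δ + 1)) +
      riemannLiouville a ε ψ y) : A = 0 := by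
  have h1 := ((tendsto_nhdsGT_of_continuousOn hab hgc).sub
    (tendsto_riemannLiouville hab hε hψ)).mul (tendsto_sub_rpow (a := a) (neg_pos.2 hδ))
  rw [mul_zero] at h1
  have h2 : Tendsto (fun _ : ℝ => A / Real.Gamma (δ + 1)) (𝓝[>] a) (𝓝 0) := by
    refine h1.congr' ?_
    filter_upwards [Ioc_mem_nhdsGT hab] with y hy
    have hy0 : 0 < y - a := sub_pos.2 hy.1
    rw [hg y hy, add_sub_cancel_right, Real.rpow_neg hy0.le]
    have := (Real.rpow_pos_of_pos hy0 δ).ne'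
    field_simp
  have h3 := tendsto_nhds_unique h2 tendsto_const_nhds
  exact ((div_eq_zero_iff).1 h3.symm).resolve_right (Real.Gamma_pos_of_pos hδ1).ne'

end Limits

/-! ### Iterated Caputo derivatives -/

section Iterate

variable {a b α : ℝ} {f : ℝ → ℝ}

/-- As `0 ∉ [a, b]`, the factor `x ^ p` is continuous there. -/
theorem continuousOn_caputo_iterate (ha : 0 < a) (hf : f ∈ smoothFrac a b α) (k : ℕ) :
    ContinuousOn ((caputo a b α)^[k] f) (Icc a b) := by
  obtain ⟨p, -, g, hg, h⟩ := hf.2 k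
  refine ContinuousOn.congr (ContinuousOn.mul ?_ hg) h
  exact continuousOn_id.rpow_const fun x hx => Or.inl (ha.trans_le hx.1).ne'

theorem continuousOn_iteratedDerivWithin_Icc (hab : a < b) (hf : ContDiffOn ℝ ∞ f (Icc a b))
    (j : ℕ) : ContinuousOn (iteratedDerivWithin j f (Icc a b)) (Icc a b) :=
  hf.continuousOn_iteratedDerivWithin (by exact_mod_cast le_top) (uniqueDiffOn_Icc hab)

/-- Integration by parts for the derivatives of a smooth function. -/
theorem riemannLiouville_iteratedDerivWithin (hf : ContDiffOn ℝ ∞ f (Icc a b)) (j : ℕ) {δ x : ℝ}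
    (hδ : 0 < δ) (hx : x ∈ Ioc a b) :
    riemannLiouville a δ (iteratedDerivWithin j f (Icc a b)) x =
      iteratedDerivWithin j f (Icc a b) a * ((x - a) ^ δ / Real.Gamma (δ + 1)) +
        riemannLiouville a (δ + 1) (iteratedDerivWithin (j + 1) f (Icc a b)) x := by
  have hab := hx.1.trans_le hx.2
  refine riemannLiouville_eq_add hδ hx (continuousOn_iteratedDerivWithin_Icc hab hf j)
    (continuousOn_iteratedDerivWithin_Icc hab hf (j + 1)) fun y hy => ?_
  rw [iteratedDerivWithin_succ]
  exact (hf.differentiableOn_iteratedDerivWithin (by exact_mod_cast WithTop.coe_lt_top _)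
    (uniqueDiffOn_Icc hab) y hy).hasDerivWithinAt

/-- The expansion at `a` of the iterated Caputo derivatives of `f ∈ C_α^∞([a, b])`, and the
vanishing of those derivatives of `f` at `a` whose order is no multiple of `α`. -/
theorem exists_expansion_caputo_iterate (ha : 0 < a) (hab : a < b) (hα : 0 < α) (hα1 : α ≤ 1)
    (hf : f ∈ smoothFrac a b α) (k : ℕ) :
    ∃ (m : ℕ) (γ c : ℝ), γ = m - k * α ∧ 0 < γ ∧ γ ≤ 1 ∧
      (∀ x ∈ Ioc a b, (caputo a b α)^[k] f x =
        c + iteratedDerivWithin m f (Icc a b) a * ((x - a) ^ γ / Real.Gamma (γ + 1)) +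
          riemannLiouville a (γ + 1) (iteratedDerivWithin (m + 1) f (Icc a b)) x) ∧
      (∀ j < m, iteratedDerivWithin j f (Icc a b) a ≠ 0 → ∃ i : ℕ, (i : ℝ) * α = j) ∧
      (∀ j : ℕ, (k : ℝ) * α = j →
        (caputo a b α)^[k] f a = iteratedDerivWithin j f (Icc a b) a) ∧
      ((∀ j : ℕ, (k : ℝ) * α ≠ j) → (caputo a b α)^[k] f a = 0) := by
  have hφ := continuousOn_iteratedDerivWithin_Icc hab hf.1
  induction k with
  | zero =>
    -- For `k = 0` this is the first-order Taylor expansion of `f` with integral remainder.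
    refine ⟨1, 1, f a, by simp, one_pos, le_rfl, fun x hx => ?_, fun j hj _ => ⟨0, ?_⟩,
      fun j hj => ?_, fun h => ?_⟩
    · have h0 := riemannLiouville_iteratedDerivWithin hf.1 1 one_pos hx
      have hsub : Icc a x ⊆ Icc a b := Icc_subset_Icc_right hx.2
      have h2 := intervalIntegral.integral_eq_sub_of_hasDeriv_right_of_le (f := f)
        (f' := iteratedDerivWithin 1 f (Icc a b)) hx.1.le
        (hf.1.continuousOn.mono hsub)
        (fun z hz => by
          rw [iteratedDerivWithin_one]
          exact ((hf.1.differentiableOn (by simp) z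
            (hsub (Ioo_subset_Icc_self hz))).hasDerivWithinAt.hasDerivAt
            (Icc_mem_nhds hz.1 (hz.2.trans_le hx.2))).hasDerivWithinAt)
        (((hφ 1).mono hsub).intervalIntegrable_of_Icc hx.1.le)
      rw [riemannLiouville_one, h2] at h0
      simp only [Function.iterate_zero, id]
      linarith
    · simp [Nat.lt_one_iff.1 hj]
    · have : j = 0 := by simpa using hj.symm
      simp [this]
    · exact absurd (by simp) (h 0)
  | succ k ih =>
    obtain ⟨m, γ, c, hγ, hγ0, hγ1, hexp, hvan, -, -⟩ := ih
    have hcont := continuousOn_caputo_iterate ha hf (k + 1)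
    have hstep : ∀ x ∈ Ioc a b, (caputo a b α)^[k + 1] f x =
        iteratedDerivWithin m f (Icc a b) a * ((x - a) ^ (γ - α) / Real.Gamma (γ - α + 1)) +
          riemannLiouville a (γ + 1 - α) (iteratedDerivWithin (m + 1) f (Icc a b)) x := by
      intro x hx
      rw [Function.iterate_succ_apply']
      exact caputo_of_eqOn hα hα1 hγ0 (hφ (m + 1)) hexp hx
    have hk1 : ((k + 1 : ℕ) : ℝ) * α = m - (γ - α) := by push_cast; linarith
    have hε : 0 < γ + 1 - α := by linarith
    rcases lt_trichotomy γ α with hlt | heq | hgt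
    -- The integer `m` lies strictly between `k * α` and `(k + 1) * α`: the new exponent is
    -- negative, so the coefficient vanishes and the next derivative takes the lead.
    · have hA : iteratedDerivWithin m f (Icc a b) a = 0 :=
        coeff_eq_zero_of_expansion hab (sub_neg.2 hlt) (by linarith) hε (hφ (m + 1)) hcont hstep
      have hexp' : ∀ x ∈ Ioc a b, (caputo a b α)^[k + 1] f x =
          0 + iteratedDerivWithin (m + 1) f (Icc a b) a *
            ((x - a) ^ (γ + 1 - α) / Real.Gamma (γ + 1 - α + 1)) +
          riemannLiouville a (γ + 1 - α + 1) (iteratedDerivWithin (m + 1 + 1) f (Icc a b)) x := by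
        intro x hx
        rw [hstep x hx, hA, riemannLiouville_iteratedDerivWithin hf.1 (m + 1) hε hx]
        ring
      refine ⟨m + 1, γ + 1 - α, 0, by rw [hk1]; push_cast; ring, hε, by linarith, hexp',
        fun j hj hne => ?_, fun j hj => ?_, fun _ => ?_⟩
      · rcases Nat.lt_succ_iff_lt_or_eq.1 hj with h | rfl
        · exact hvan j h hne
        · exact absurd hA hne
      · rw [hk1] at hj
        have h1 : (m : ℝ) < j := by linarith
        have h2 : (j : ℝ) < m + 1 := by linarith
        have h1' : m < j := by exact_mod_cast h1
        have h2' : j < m + 1 := by exact_mod_cast h2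
        omega
      · exact apply_eq_of_expansion hab hε (by linarith) (hφ (m + 1 + 1)) hcont hexp'
    -- Here `(k + 1) * α = m`: the leading term has become the constant value at `a`, and the
    -- integral is expanded once more.
    · have hexp' : ∀ x ∈ Ioc a b, (caputo a b α)^[k + 1] f x =
          iteratedDerivWithin m f (Icc a b) a + iteratedDerivWithin (m + 1) f (Icc a b) a *
            ((x - a) ^ (1 : ℝ) / Real.Gamma (1 + 1)) +
          riemannLiouville a (1 + 1) (iteratedDerivWithin (m + 1 + 1) f (Icc a b)) x := by
        intro x hx
        rw [hstep x hx, heq, sub_self, add_sub_cancel_left,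
          riemannLiouville_iteratedDerivWithin hf.1 (m + 1) one_pos hx, Real.rpow_zero, zero_add,
          Real.Gamma_one]
        ring
      have hk2 : ((k + 1 : ℕ) : ℝ) * α = m := by rw [hk1, heq]; ring
      have hval := apply_eq_of_expansion hab one_pos (by norm_num) (hφ (m + 1 + 1)) hcont hexp'
      refine ⟨m + 1, 1, _, by rw [hk2]; push_cast; ring, one_pos, le_rfl, hexp',
        fun j hj hne => ?_, fun j hj => ?_, fun h => absurd hk2 (h m)⟩
      · rcases Nat.lt_succ_iff_lt_or_eq.1 hj with h | rfl
        · exact hvan j h hne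
        · exact ⟨k + 1, hk2⟩
      · have : m = j := by exact_mod_cast hk2.symm.trans hj
        rw [hval, this]
    -- No integer is reached: `(k + 1) * α` lies strictly between `m - 1` and `m`, so `m` stays and
    -- the value at `a` is zero.
    · have hδ : 0 < γ - α := sub_pos.2 hgt
      have e : γ + 1 - α = γ - α + 1 := by ring
      have hexp' : ∀ x ∈ Ioc a b, (caputo a b α)^[k + 1] f x =
          0 + iteratedDerivWithin m f (Icc a b) a *
            ((x - a) ^ (γ - α) / Real.Gamma (γ - α + 1)) +
          riemannLiouville a (γ - α + 1) (iteratedDerivWithin (m + 1) f (Icc a b)) x := by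
        intro x hx
        rw [hstep x hx, e, zero_add]
      refine ⟨m, γ - α, 0, by rw [hk1]; ring, hδ, by linarith, hexp', hvan, fun j hj => ?_,
        fun _ => ?_⟩
      · rw [hk1] at hj
        have h1 : (j : ℝ) < m := by linarith
        have h2 : (m : ℝ) < j + 1 := by linarith
        have h1' : j < m := by exact_mod_cast h1
        have h2' : m < j + 1 := by exact_mod_cast h2
        omega
      · exact apply_eq_of_expansion hab hδ (by linarith) (hφ (m + 1)) hcont hexp'

theorem iteratedDerivWithin_eq_zero_of_smoothFrac (ha : 0 < a) (hab : a < b) (hα : 0 < α)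
    (hα1 : α ≤ 1) (hf : f ∈ smoothFrac a b α) {j : ℕ} (hj : ∀ i : ℕ, (i : ℝ) * α ≠ j) :
    iteratedDerivWithin j f (Icc a b) a = 0 := by
  -- Any `k` with `k * α > j` works, since then `m > k * α > j` and the vanishing clause covers `j`.
  obtain ⟨k, hk⟩ := exists_nat_gt (j / α)
  obtain ⟨m, γ, c, hγ, hγ0, -, -, hvan, -, -⟩ :=
    exists_expansion_caputo_iterate ha hab hα hα1 hf k
  by_contra hne
  have hjm : (j : ℝ) < m := by
    rw [div_lt_iff₀ hα] at hk
    linarith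
  obtain ⟨i, hi⟩ := hvan j (by exact_mod_cast hjm) hne
  exact hj i hi

theorem caputo_iterate_apply_of_eq (ha : 0 < a) (hab : a < b) (hα : 0 < α)
    (hα1 : α ≤ 1) (hf : f ∈ smoothFrac a b α) {k j : ℕ} (hj : (k : ℝ) * α = j) :
    (caputo a b α)^[k] f a = iteratedDerivWithin j f (Icc a b) a := by
  obtain ⟨m, γ, c, -, -, -, -, -, h, -⟩ := exists_expansion_caputo_iterate ha hab hα hα1 hf k
  exact h j hj

theorem caputo_iterate_apply_of_ne (ha : 0 < a) (hab : a < b) (hα : 0 < α)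
    (hα1 : α ≤ 1) (hf : f ∈ smoothFrac a b α) {k : ℕ} (hk : ∀ j : ℕ, (k : ℝ) * α ≠ j) :
    (caputo a b α)^[k] f a = 0 := by
  obtain ⟨m, γ, c, -, -, -, -, -, -, h⟩ := exists_expansion_caputo_iterate ha hab hα hα1 hf k
  exact h hk

end Iterate

/-! ### The fractional Taylor formula -/

/-- The fractional Taylor polynomial at an infinitesimal is the classical one. -/
theorem sum_caputo_smul_infPow {a b α : ℝ} {f : ℝ → ℝ} (ha : 0 < a) (hab : a < b) (hα : 0 < α)
    (hα1 : α ≤ 1) (hf : f ∈ smoothFrac a b α) {n : ℕ} {h : FermatReal}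
    (hs : stdPart h = 0) (ho : order h < (n + 1) * α) :
    ∑ i ∈ Finset.range (n + 1), ((caputo a b α)^[i] f a / Real.Gamma (i * α + 1)) •
        infPow h (i * α) =
      ∑ j ∈ Finset.range (n + 2), (iteratedDerivWithin j f (Icc a b) a / j.factorial) • h ^ j := by
  classical
  set φ : ℕ → FermatReal := fun j =>
    (iteratedDerivWithin j f (Icc a b) a / j.factorial) • h ^ j with hφ
  -- Both sums are compared through the double sum over pairs with `i * α = j`, where each index
  -- determines the other because `α > 0`.
  have h1 : ∀ i ∈ Finset.range (n + 1),
      ((caputo a b α)^[i] f a / Real.Gamma (i * α + 1)) • infPow h (i * α) =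
        ∑ j ∈ Finset.range (n + 2), if (i : ℝ) * α = j then φ j else 0 := by
    intro i hi
    by_cases hij : ∃ j : ℕ, (i : ℝ) * α = j
    · obtain ⟨j, hj⟩ := hij
      have hji : (j : ℝ) ≤ i := by rw [← hj]; exact mul_le_of_le_one_right (Nat.cast_nonneg i) hα1
      have hji' : j ≤ i := by exact_mod_cast hji
      have hjn : j ∈ Finset.range (n + 2) := by
        rw [Finset.mem_range] at hi ⊢
        omega
      rw [Finset.sum_eq_single_of_mem j hjn fun l _ hl => if_neg fun h' => hl ?_, if_pos hj, hj,
        infPow_natCast hs, caputo_iterate_apply_of_eq ha hab hα hα1 hf hj,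
        Real.Gamma_nat_eq_factorial]
      exact_mod_cast h'.symm.trans hj
    · push Not at hij
      rw [caputo_iterate_apply_of_ne ha hab hα hα1 hf hij, zero_div, zero_smul]
      exact (Finset.sum_eq_zero fun j _ => if_neg (hij j)).symm
  rw [Finset.sum_congr rfl h1, Finset.sum_comm]
  refine Finset.sum_congr rfl fun j _ => ?_
  by_cases hj : ∃ i : ℕ, (i : ℝ) * α = j
  · obtain ⟨i, hi⟩ := hj
    have huniq : ∀ l : ℕ, (l : ℝ) * α = j → l = i := fun l hl => by
      exact_mod_cast mul_right_cancel₀ hα.ne' (hl.trans hi.symm)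
    by_cases hin : i ∈ Finset.range (n + 1)
    · rw [Finset.sum_eq_single_of_mem i hin fun l _ hl => if_neg fun h' => hl (huniq l h'),
        if_pos hi]
    -- A classical term without fractional counterpart: `j = i * α ≥ (n + 1) * α` exceeds the order
    -- of `h`.
    · have hni : n + 1 ≤ i := by simpa using hin
      have hni' : ((n : ℝ) + 1) ≤ i := by exact_mod_cast hni
      have hlt : order h < j := ho.trans_le (hi ▸ mul_le_mul_of_nonneg_right hni' hα.le)
      have hj0 : j ≠ 0 := by
        rintro rfl
        have : (0 : ℝ) < i * α := mul_pos (by linarith [Nat.cast_nonneg (α := ℝ) n]) hα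
        simp [hi] at this
      rw [hφ]
      simp only
      rw [pow_eq_zero_of_order_lt hs hj0 hlt, smul_zero]
      simp
  · push Not at hj
    rw [hφ]
    simp only
    rw [iteratedDerivWithin_eq_zero_of_smoothFrac ha hab hα hα1 hf hj]
    simp

/-- Common core of both parts: the domain `A` enters only through Taylor's theorem at `a` and
through a representative staying in it. Order `n + 1` suffices, as `order h < (n + 1) * α ≤ n + 1`.
-/
theorem hasExtValue_of_smoothFrac {a b α : ℝ} {f : ℝ → ℝ} (ha : 0 < a) (hab : a < b) (hα : 0 < α)
    (hα1 : α ≤ 1) (hf : f ∈ smoothFrac a b α) {n : ℕ} {h : FermatReal}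
    (hh : h ∈ D ((n + 1) * α - 1)) {A : Set ℝ} (hA : Convex ℝ A) (haA : a ∈ A)
    (hfA : ContDiffOn ℝ ∞ f A)
    (hd : ∀ j, iteratedDerivWithin j f A a = iteratedDerivWithin j f (Icc a b) a)
    (hex : ∃ v : littleOhPoly, toFermat v = h ∧
      ∀ᶠ t in 𝓝[>] (0 : ℝ≥0), a + (v : ℝ≥0 → ℝ) t ∈ A) :
    HasExtValue f A (algebraMap ℝ FermatReal a + h)
      (∑ i ∈ Finset.range (n + 1),
        ((caputo a b α)^[i] f a / Real.Gamma (i * α + 1)) • infPow h (i * α)) := by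
  obtain ⟨hs, ho⟩ := hh
  rw [sub_add_cancel] at ho
  have hlt : order h < (n + 1 : ℕ) := by
    push_cast
    exact ho.trans_le (mul_le_of_le_one_right (by positivity) hα1)
  rw [sum_caputo_smul_infPow ha hab hα hα1 hf hs ho]
  refine hasExtValue_of_isLittleO (M := n + 1) ?_ hs
    (pow_eq_zero_of_order_lt hs n.succ_ne_zero hlt) hex
  refine (taylor_isLittleO (n := n + 1) hA haA
    (hfA.of_le (by exact_mod_cast le_top))).congr_left fun x => ?_
  rw [taylor_within_apply]
  congr 1
  refine Finset.sum_congr rfl fun j _ => ?_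
  rw [hd, smul_eq_mul]
  ring

end Fermat

end

theorem mainTheorem12 (α a' a b : ℝ) (n : ℕ) (ha' : 0 ≤ a') (ha : a' < a) (hab : a < b)
    (hα : 0 < α) (hα1 : α ≤ 1) (f : ℝ → ℝ) (hf : f ∈ Fermat.smoothFrac a b α) :
    (∀ h ∈ Fermat.D ((n + 1) * α - 1), 0 ≤ h →
      Fermat.HasExtValue f (Set.Icc a b) (algebraMap ℝ Fermat.FermatReal a + h)
        (∑ i ∈ Finset.range (n + 1),
          ((Fermat.caputo a b α)^[i] f a / Real.Gamma (i * α + 1)) •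
            Fermat.infPow h (i * α))) ∧
    (ContDiffOn ℝ ∞ f (Set.Ioo a' b) →
      ∀ h ∈ Fermat.D ((n + 1) * α - 1), (∀ i ≤ n, Fermat.PowDefined h (i * α)) →
        Fermat.HasExtValue f (Set.Ioo a' b) (algebraMap ℝ Fermat.FermatReal a + h)
          (∑ i ∈ Finset.range (n + 1),
            ((Fermat.caputo a b α)^[i] f a / Real.Gamma (i * α + 1)) •
              Fermat.infPow h (i * α))) := by
  have ha0 : 0 < a := ha'.trans_lt ha
  refine ⟨fun h hh h0 => ?_, fun hfA h hh _ => ?_⟩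
  · refine Fermat.hasExtValue_of_smoothFrac ha0 hab hα hα1 hf hh (convex_Icc a b)
      (left_mem_Icc.2 hab.le) hf.1 (fun _ => rfl) ?_
    obtain ⟨v, hv, hv0⟩ := Fermat.exists_nonneg_rep h0
    have hlim := (Fermat.hasLimit_stdPart h).tendsto hv
    rw [hh.1] at hlim
    refine ⟨v, hv, ?_⟩
    filter_upwards [hv0, hlim.eventually (gt_mem_nhds (sub_pos.2 hab))] with t ht ht'
    exact ⟨by linarith, by linarith⟩
  · have haA : a ∈ Ioo a' b := ⟨ha, hab⟩
    have hfa : ContDiffAt ℝ ∞ f a := hfA.contDiffAt (Ioo_mem_nhds ha hab)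
    refine Fermat.hasExtValue_of_smoothFrac ha0 hab hα hα1 hf hh (convex_Ioo a' b) haA hfA
      (fun j => ?_) ?_
    -- Smoothness on a neighbourhood of `a` makes the derivatives within `[a, b]` agree with the
    -- two-sided ones.
    · have hfj : ContDiffAt ℝ j f a := hfa.of_le (by exact_mod_cast le_top)
      rw [iteratedDerivWithin_eq_iteratedDeriv (uniqueDiffOn_Ioo a' b) hfj haA,
        iteratedDerivWithin_eq_iteratedDeriv (uniqueDiffOn_Icc hab) hfj (left_mem_Icc.2 hab.le)]
    -- Here `a` is interior to the domain, so every representative will do, whatever the sign of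
    -- `h`.
    · obtain ⟨v, hv⟩ := Fermat.exists_rep h
      have hlim := ((Fermat.hasLimit_stdPart h).tendsto hv).const_add a
      rw [hh.1, add_zero] at hlim
      exact ⟨v, hv, hlim.eventually (Ioo_mem_nhds ha hab)⟩
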